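/- An $r$-graph is an $r$-uniform hypergraph without repeated edges. A (Berge) cycle of length $k\ge 2$ in a hypergraph consists of distinct vertices $v_1,\dots,v_k$ and distinct edges $e_1,\dots,e_k$ with $v_i,v_{i+1}\in e_i$ for every $i$ (indices modulo $k$); the girth is the length of a shortest cycle ($\infty$ if there is none). Let $h_r(n,g)$ be the maximum number of edges of an $r$-graph on $n$ vertices of girth greater than $g$. A $(v,e)$-configuration in a hypergraph is a subgraph with $e$ edges and at most $v$ vertices, and $f(n,v,e)$ is the maximum number of edges of a $3$-graph on $n$ vertices without a $(v,e)$-configuration. For every fixed $r\ge 3$, \[ h_r(n,5)=o(n^{3/2}) \quad\text{as } n\to\infty, \] i.e. every $r$-graph on $n$ vertices of girth greater than $5$ has $o(n^{3/2})$ edges. Moreover, \[ f(n,10,5)=o(n^{3/2}) \quad\text{as } n\to\infty. \] -/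

import Mathlib

open Filter Asymptotics

namespace Hypergraph

/-- `H` is an `r`-graph (an `r`-uniform hypergraph) with exactly `n` vertices. -/
structure IsUniformOn {α : Type*} (H : Hypergraph α) (r n : ℕ) : Prop where
  vertexSet_encard : H.vertexSet.encard = n
  edge_encard : ∀ e ∈ H.edgeSet, e.encard = r

/-- `H` contains a Berge cycle of length `k ≥ 2`: distinct vertices `v 0, …, v (k-1)` and distinct
edges `e 0, …, e (k-1)` such that `v i` and `v (i+1)` lie in `e i`, with indices modulo `k`
(`finRotate k` is the cyclic successor on `Fin k`). -/
def HasBergeCycle {α : Type*} (H : Hypergraph α) (k : ℕ) : Prop :=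
  2 ≤ k ∧ ∃ (v : Fin k → α) (e : Fin k → Set α),
    Function.Injective v ∧ Function.Injective e ∧
      ∀ i, e i ∈ H.edgeSet ∧ v i ∈ e i ∧ v (finRotate k i) ∈ e i

/-- The girth: the length of a shortest Berge cycle (`⊤` if there is none). -/
noncomputable def bergeGirth {α : Type*} (H : Hypergraph α) : ℕ∞ :=
  ⨅ (k : ℕ) (_ : H.HasBergeCycle k), (k : ℕ∞)

/-- `F` is a subgraph of `H`. -/
def IsSubgraphOf {α : Type*} (F H : Hypergraph α) : Prop :=
  F.vertexSet ⊆ H.vertexSet ∧ F.edgeSet ⊆ H.edgeSet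

/-- `H` contains a `(v, e)`-configuration: a subgraph with `e` edges and at most `v` vertices. -/
def HasConfiguration {α : Type*} (H : Hypergraph α) (v e : ℕ) : Prop :=
  ∃ F : Hypergraph α, F.IsSubgraphOf H ∧ F.edgeSet.encard = e ∧ F.vertexSet.encard ≤ v

/-- The possible numbers of edges of an `n`-vertex `r`-graph of girth larger than `g`. -/
def girthEdgeCounts (r n g : ℕ) : Set ℕ :=
  {m | ∃ H : Hypergraph (Fin n), H.IsUniformOn r n ∧ (g : ℕ∞) < H.bergeGirth ∧
    H.edgeSet.ncard = m}

/-- The possible numbers of edges of an `n`-vertex `r`-graph without a `(v, e)`-configuration. -/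
def configurationFreeEdgeCounts (r n v e : ℕ) : Set ℕ :=
  {m | ∃ H : Hypergraph (Fin n), H.IsUniformOn r n ∧ ¬ H.HasConfiguration v e ∧
    H.edgeSet.ncard = m}

/-- `h_r(n, g)`: the maximum number of edges of an `n`-vertex `r`-graph of girth larger than `g`. -/
noncomputable def maxEdgesGirth (r n g : ℕ) : ℕ := sSup (girthEdgeCounts r n g)

/-- `f_r(n, v, e)`: the maximum number of edges of an `n`-vertex `r`-graph without a
`(v, e)`-configuration. -/
noncomputable def maxEdgesConfigurationFree (r n v e : ℕ) : ℕ :=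
  sSup (configurationFreeEdgeCounts r n v e)

/-- The edgeless hypergraph on all of `Fin n`. -/
def edgeless (n : ℕ) : Hypergraph (Fin n) where
  vertexSet := Set.univ
  edgeSet := ∅
  subset_vertexSet_of_mem_edgeSet' := by simp

lemma edgeless_isUniformOn (r n : ℕ) : (edgeless n).IsUniformOn r n :=
  ⟨by simp [edgeless], by simp [edgeless]⟩

/-- The supremum defining `h_r(n, g)` is a maximum. -/
lemma isGreatest_maxEdgesGirth (r n g : ℕ) :
    IsGreatest (girthEdgeCounts r n g) (maxEdgesGirth r n g) := by
  have hb : BddAbove (girthEdgeCounts r n g) := by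
    refine ⟨Nat.card (Set (Fin n)), ?_⟩
    rintro m ⟨H, -, -, rfl⟩
    exact Set.ncard_le_card _
  refine ⟨Nat.sSup_mem ⟨0, edgeless n, edgeless_isUniformOn r n, ?_, by simp [edgeless]⟩ hb,
    fun m hm => le_csSup hb hm⟩
  have hc : ∀ k, ¬ (edgeless n).HasBergeCycle k := by
    rintro k ⟨hk, v, e, -, -, h⟩
    exact (h ⟨0, by omega⟩).1
  simp [bergeGirth, hc]

/-- The supremum defining `f_r(n, v, e)` is a maximum when `e ≥ 1`. -/
lemma isGreatest_maxEdgesConfigurationFree (r n v e : ℕ) (he : 1 ≤ e) :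
    IsGreatest (configurationFreeEdgeCounts r n v e) (maxEdgesConfigurationFree r n v e) := by
  have hb : BddAbove (configurationFreeEdgeCounts r n v e) := by
    refine ⟨Nat.card (Set (Fin n)), ?_⟩
    rintro m ⟨H, -, -, rfl⟩
    exact Set.ncard_le_card _
  refine ⟨Nat.sSup_mem ⟨0, edgeless n, edgeless_isUniformOn r n, ?_, by simp [edgeless]⟩ hb,
    fun m hm => le_csSup hb hm⟩
  rintro ⟨F, ⟨-, hF⟩, hFe, -⟩
  have h0 : F.edgeSet = ∅ := Set.subset_empty_iff.mp hF
  rw [h0, Set.encard_empty] at hFe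
  have : e = 0 := by exact_mod_cast hFe.symm
  omega

end Hypergraph

/-! Everything reduces to graphs: a graph on `n` vertices without four- and five-cycles has
`o(n^(3/2))` triangles (`sum_triangleKernel_lt`). An `r`-graph of girth greater than 5 shrinks to a
3-graph with equally many edges; its shadow has no `C₄` or `C₅`, and distinct edges span distinct
triangles. A 3-graph without (10,5)-configurations reaches this case after the deletion of at most
`4n` edges.

The graph is sparse, but without `C₄` two vertices have at most one common neighbour, so off the
diagonal the square of the adjacency matrix `A` is a 0-1 kernel, the cherry kernel `s`. Dense weak
regularity gives a block average `s'` close to `s` in the four-cycle norm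
(`exists_regular_coloring`). The sum of `A(y,z) s(z,w) s(w,y)` counts edges `yz` joined by two
cherries through `w`; without five-cycles these are degenerate, so it is `O(n²)`. Replacing `s` by
`s'` costs only a small multiple of `n^(5/2)` (`sum_adj_blockAverage_le`).

Conversely, suppose there are `ε n^(3/2)` triangles `xyz`. For a typical neighbour `w` of `x`, both
`yxw` and `zxw` are cherries, so `w` mostly lies in the set `Y(y,z)` of vertices in dense blocks
with both `y` and `z`. This set depends only on the colours of `y` and `z`, and small sets receive
few edges, so `Y(y,z)` has linear size for a constant times `n^(3/2)` edges `yz`. The sum with `s'`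
is then at least a constant times `n^(5/2)` (`le_sum_adj_blockAverage`), a contradiction for large
`n`. -/

namespace BergeGirth

/-! ### Averages over the blocks of a partition. -/

open Finset

/-- The average of `f` over the fibre of `π` through `x`. -/
noncomputable def fiberAverage {X ι : Type*} [Fintype X] [DecidableEq ι] (π : X → ι) (f : X → ℝ)
    (x : X) : ℝ :=
  (∑ y with π y = π x, f y) / (#{y | π y = π x} : ℝ)

section FiberAverage

variable {X ι : Type*} [Fintype X] [DecidableEq ι] (π : X → ι) (f : X → ℝ)

lemma card_fiber_pos (x : X) : (0 : ℝ) < (#{y | π y = π x} : ℝ) := by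
  exact_mod_cast Finset.card_pos.2 ⟨x, by simp⟩

lemma fiberAverage_congr {x y : X} (h : π x = π y) :
    fiberAverage π f x = fiberAverage π f y := by
  simp [fiberAverage, h]

lemma fiberAverage_nonneg (hf : ∀ x, 0 ≤ f x) (x : X) : 0 ≤ fiberAverage π f x :=
  div_nonneg (sum_nonneg fun y _ => hf y) (Nat.cast_nonneg _)

lemma fiberAverage_le_one (hf : ∀ x, f x ≤ 1) (x : X) : fiberAverage π f x ≤ 1 := by
  rw [fiberAverage, div_le_one (card_fiber_pos π x)]
  calc (∑ y with π y = π x, f y) ≤ ∑ y with π y = π x, (1 : ℝ) := sum_le_sum fun y _ => hf y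
    _ = _ := by simp

/-- Averaging over fibres does not change the inner product with a function that is constant on
the fibres. -/
lemma sum_fiberAverage_mul (h : X → ℝ) (hh : ∀ x y, π x = π y → h x = h y) :
    ∑ x, fiberAverage π f x * h x = ∑ x, f x * h x := by
  have h1 : ∀ x, fiberAverage π f x * h x =
      ∑ y, if π y = π x then f y * h y / (#{z | π z = π y} : ℝ) else 0 := by
    intro x
    rw [fiberAverage, div_mul_eq_mul_div, sum_mul, sum_div, ← sum_filter]
    refine sum_congr rfl fun y hy => ?_
    have hy' : π y = π x := (mem_filter.1 hy).2
    rw [hh y x hy', hy']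
  simp_rw [h1]
  rw [sum_comm]
  refine sum_congr rfl fun y _ => ?_
  have h2 : (∑ x, if π y = π x then f y * h y / (#{z | π z = π y} : ℝ) else 0) =
      (#{z | π z = π y} : ℝ) * (f y * h y / (#{z | π z = π y} : ℝ)) := by
    rw [← sum_filter, sum_const, nsmul_eq_mul]
    simp_rw [eq_comm (a := π y)]
  rw [h2, mul_div_cancel₀ _ (card_fiber_pos π y).ne']

end FiberAverage

/-- The average of the kernel `s` over the blocks of the partition given by the colouring `κ`. -/
noncomputable def blockAverage {V ι : Type*} [Fintype V] [DecidableEq ι] (κ : V → ι)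
    (s : V → V → ℝ) (a b : V) : ℝ :=
  fiberAverage (fun p : V × V => (κ p.1, κ p.2)) (fun p => s p.1 p.2) (a, b)

section BlockAverage

variable {V ι : Type*} [Fintype V] [DecidableEq ι] (κ : V → ι) (s : V → V → ℝ)

lemma blockAverage_congr {a a' b b' : V} (ha : κ a = κ a') (hb : κ b = κ b') :
    blockAverage κ s a b = blockAverage κ s a' b' :=
  fiberAverage_congr _ _ (by simp [ha, hb])

lemma blockAverage_nonneg (hs : ∀ a b, 0 ≤ s a b) (a b : V) : 0 ≤ blockAverage κ s a b :=
  fiberAverage_nonneg _ _ (fun _ => hs _ _) _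

lemma blockAverage_le_one (hs : ∀ a b, s a b ≤ 1) (a b : V) : blockAverage κ s a b ≤ 1 :=
  fiberAverage_le_one _ _ (fun _ => hs _ _) _

/-- Block averaging is the orthogonal projection onto the kernels constant on blocks, so it can be
dropped against such a kernel. -/
lemma sum_blockAverage_mul (h : V → V → ℝ)
    (hh : ∀ a a' b b', κ a = κ a' → κ b = κ b' → h a b = h a' b') :
    ∑ a, ∑ b, blockAverage κ s a b * h a b = ∑ a, ∑ b, s a b * h a b := by
  have := sum_fiberAverage_mul (fun p : V × V => (κ p.1, κ p.2)) (fun p => s p.1 p.2)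
    (fun p => h p.1 p.2) (by
      rintro ⟨a, b⟩ ⟨a', b'⟩ hp
      simp only [Prod.mk.injEq] at hp
      exact hh _ _ _ _ hp.1 hp.2)
  rw [Fintype.sum_prod_type, Fintype.sum_prod_type] at this
  exact this

lemma blockAverage_symm (hs : ∀ a b, s a b = s b a) (a b : V) :
    blockAverage κ s a b = blockAverage κ s b a := by
  unfold blockAverage fiberAverage
  have e : (univ.filter fun y : V × V => (κ y.1, κ y.2) = (κ b, κ a)) =
      (univ.filter fun y : V × V => (κ y.1, κ y.2) = (κ a, κ b)).map
        (Equiv.prodComm V V).toEmbedding := by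
    ext ⟨x, y⟩
    simp [and_comm]
  rw [e, sum_map, card_map]
  congr 1
  exact sum_congr rfl fun y _ => by simp [hs y.1 y.2]

/-- Pythagoras for block averages with respect to a colouring and a refinement of it. -/
lemma sum_blockAverage_sub_sq {ι' : Type*} [DecidableEq ι'] (κ' : V → ι')
    (hκ : ∀ a b, κ' a = κ' b → κ a = κ b) :
    ∑ a, ∑ b, (blockAverage κ' s a b - blockAverage κ s a b) ^ 2 =
      ∑ a, ∑ b, blockAverage κ' s a b ^ 2 - ∑ a, ∑ b, blockAverage κ s a b ^ 2 := by
  -- The coarse average is constant on fine blocks too, so its products with `s`, the fine average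
  -- and itself agree.
  have h1 := sum_blockAverage_mul κ s (blockAverage κ s)
    fun a a' b b' ha hb => blockAverage_congr κ s ha hb
  have h2 := sum_blockAverage_mul κ' s (blockAverage κ s)
    fun a a' b b' ha hb => blockAverage_congr κ s (hκ _ _ ha) (hκ _ _ hb)
  have h3 : ∀ a b, (blockAverage κ' s a b - blockAverage κ s a b) ^ 2 =
      blockAverage κ' s a b ^ 2 - 2 * (blockAverage κ' s a b * blockAverage κ s a b) +
        blockAverage κ s a b * blockAverage κ s a b := fun a b => by ring
  simp_rw [h3, sum_add_distrib, sum_sub_distrib, ← mul_sum, h2, ← h1, sq]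
  ring

end BlockAverage

/-! ### Energy increment and weak regularity. -/

section Regularity

variable {V : Type*} [Fintype V]

lemma sum_sum_mul_sq_le (f g : V → V → ℝ) :
    (∑ a, ∑ b, f a b * g a b) ^ 2 ≤ (∑ a, ∑ b, f a b ^ 2) * ∑ a, ∑ b, g a b ^ 2 := by
  have := sum_mul_sq_le_sq_mul_sq (univ : Finset (V × V)) (fun p => f p.1 p.2) fun p => g p.1 p.2
  simpa only [Fintype.sum_prod_type] using this

lemma sum_sum_le_card_sq (f : V → V → ℝ) (c : ℝ) (hf : ∀ a b, f a b ≤ c) :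
    ∑ a, ∑ b, f a b ≤ c * (Fintype.card V : ℝ) ^ 2 := by
  calc ∑ a, ∑ b, f a b ≤ ∑ a : V, ∑ b : V, c := sum_le_sum fun a _ => sum_le_sum fun b _ => hf a b
    _ = _ := by simp; ring

/-- A bounded kernel with large four-cycle norm correlates with a product of one of its rows and
one of its columns. -/
lemma exists_correlation (D : V → V → ℝ) (hD : ∀ a b, |D a b| ≤ 1) (η : ℝ)
    (h : η * (Fintype.card V : ℝ) ^ 4 < ∑ x, ∑ y, (∑ w, D x w * D y w) ^ 2) :
    ∃ c d, η * (Fintype.card V : ℝ) ^ 2 < |∑ a, ∑ b, D a b * (D a d * D c b)| := by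
  by_contra! hcon
  -- Grouping the four-cycles by one edge `(c, d)` leaves the correlation of `D` with its column `d`
  -- times its row `c`.
  have h1 : ∑ x, ∑ y, (∑ w, D x w * D y w) ^ 2 =
      ∑ c, ∑ d, D c d * ∑ a, ∑ b, D a b * (D a d * D c b) := by
    rw [sum_comm]
    refine sum_congr rfl fun c _ => ?_
    calc ∑ a, (∑ w, D a w * D c w) ^ 2 =
          ∑ a, ∑ d, ∑ b, D a d * D c d * (D a b * D c b) := by simp_rw [sq, sum_mul_sum]
      _ = ∑ d, ∑ a, ∑ b, D a d * D c d * (D a b * D c b) := sum_comm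
      _ = _ := by
          simp_rw [mul_sum]
          refine sum_congr rfl fun d _ => sum_congr rfl fun a _ => sum_congr rfl fun b _ => ?_
          ring
  have h2 : ∑ c, ∑ d, D c d * ∑ a, ∑ b, D a b * (D a d * D c b) ≤
      (η * (Fintype.card V : ℝ) ^ 2) * (Fintype.card V : ℝ) ^ 2 := by
    refine sum_sum_le_card_sq _ _ fun c d => (le_abs_self _).trans ?_
    rw [abs_mul]
    calc _ ≤ 1 * |∑ a, ∑ b, D a b * (D a d * D c b)| :=
          mul_le_mul_of_nonneg_right (hD c d) (abs_nonneg _)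
      _ ≤ _ := by rw [one_mul]; exact hcon c d
  rw [h1] at h
  nlinarith

/-- One step of the energy increment. -/
lemma exists_refinement {k : ℕ} (κ : V → Fin k) (s : V → V → ℝ)
    (hs : ∀ a b, s a b = 0 ∨ s a b = 1) {η : ℝ} (hη : 0 ≤ η)
    (h : η * (Fintype.card V : ℝ) ^ 4 <
      ∑ x, ∑ y, (∑ w, (s x w - blockAverage κ s x w) * (s y w - blockAverage κ s y w)) ^ 2) :
    ∃ κ' : V → Fin (k * 4), ∑ a, ∑ b, blockAverage κ s a b ^ 2 + η ^ 2 * (Fintype.card V : ℝ) ^ 2 ≤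
      ∑ a, ∑ b, blockAverage κ' s a b ^ 2 := by
  classical
  have hs0 : ∀ a b, 0 ≤ s a b := fun a b => by rcases hs a b with h | h <;> simp [h]
  have hs1 : ∀ a b, s a b ≤ 1 := fun a b => by rcases hs a b with h | h <;> simp [h]
  have hD : ∀ a b, |s a b - blockAverage κ s a b| ≤ 1 := fun a b => by
    rw [abs_le]
    constructor <;> linarith [hs0 a b, hs1 a b, blockAverage_nonneg κ s hs0 a b,
      blockAverage_le_one κ s hs1 a b]
  obtain ⟨c, d, hcd⟩ := exists_correlation _ hD η h
  let e : (Fin k × Bool × Bool) ≃ Fin (k * 4) := Fintype.equivFinOfCardEq (by simp)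
  -- Each part is split by the 0-1 values of the column `s · d` and the row `s c ·`, hence the
  -- factor 4.
  let κ' : V → Fin (k * 4) := fun a => e (κ a, decide (s a d = 1), decide (s c a = 1))
  have hκ' : ∀ a b, κ' a = κ' b → κ a = κ b ∧ s a d = s b d ∧ s c a = s c b := by
    intro a b hab
    have h1 := e.injective hab
    simp only [Prod.mk.injEq, decide_eq_decide] at h1
    refine ⟨h1.1, ?_, ?_⟩
    · rcases hs a d with h | h <;> rcases hs b d with h' | h' <;> simp_all
    · rcases hs c a with h | h <;> rcases hs c b with h' | h' <;> simp_all
  refine ⟨κ', ?_⟩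
  have hpy := sum_blockAverage_sub_sq κ s κ' fun a b hab => (hκ' a b hab).1
  set h : V → V → ℝ := fun a b =>
    (s a d - blockAverage κ s a d) * (s c b - blockAverage κ s c b) with hh
  have hortho := sum_blockAverage_mul κ' s h (by
    intro a a' b b' ha hb
    obtain ⟨ha1, ha2, -⟩ := hκ' _ _ ha
    obtain ⟨hb1, -, hb2⟩ := hκ' _ _ hb
    simp only [hh]
    rw [ha2, hb2, blockAverage_congr κ s ha1 rfl, blockAverage_congr κ s (rfl : κ c = κ c) hb1])
  -- As `h` is constant on the new blocks, the correlation passes to the difference of the two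
  -- averages; Cauchy–Schwarz turns it into an energy gain.
  have heq : ∑ a, ∑ b, (s a b - blockAverage κ s a b) * h a b =
      ∑ a, ∑ b, (blockAverage κ' s a b - blockAverage κ s a b) * h a b := by
    simp_rw [sub_mul, sum_sub_distrib, hortho]
  have hcs := sum_sum_mul_sq_le (fun a b => blockAverage κ' s a b - blockAverage κ s a b) h
  have hh1 : ∑ a, ∑ b, h a b ^ 2 ≤ 1 * (Fintype.card V : ℝ) ^ 2 := by
    refine sum_sum_le_card_sq _ _ fun a b => ?_
    rw [sq_le_one_iff_abs_le_one, abs_mul]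
    exact mul_le_one₀ (hD _ _) (abs_nonneg _) (hD _ _)
  rw [← heq] at hcs
  have hN : 0 < (Fintype.card V : ℝ) := by
    exact_mod_cast Fintype.card_pos_iff.2 ⟨c⟩
  have hsq : (η * (Fintype.card V : ℝ) ^ 2) ^ 2 ≤
      (∑ a, ∑ b, (s a b - blockAverage κ s a b) * h a b) ^ 2 := by
    rw [← sq_abs (∑ a, ∑ b, (s a b - blockAverage κ s a b) * h a b)]
    exact pow_le_pow_left₀ (by positivity) hcd.le 2
  have hfin : η ^ 2 * (Fintype.card V : ℝ) ^ 2 * (Fintype.card V : ℝ) ^ 2 ≤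
      (∑ a, ∑ b, (blockAverage κ' s a b - blockAverage κ s a b) ^ 2) *
        (Fintype.card V : ℝ) ^ 2 := by
    calc _ = (η * (Fintype.card V : ℝ) ^ 2) ^ 2 := by ring
      _ ≤ _ := hsq.trans (hcs.trans (mul_le_mul_of_nonneg_left (by linarith)
          (sum_nonneg fun a _ => sum_nonneg fun b _ => sq_nonneg _)))
  have := le_of_mul_le_mul_right hfin (by positivity)
  linarith

end Regularity

/-- Weak regularity: a `0`-`1` kernel is close, in the four-cycle norm, to its average over the
blocks of a partition with boundedly many parts. -/
theorem exists_regular_coloring {η : ℝ} (hη : 0 < η) :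
    ∃ K : ℕ, ∀ (V : Type) [Fintype V] (s : V → V → ℝ), (∀ a b, s a b = 0 ∨ s a b = 1) →
      ∃ k ≤ K, ∃ κ : V → Fin k,
        ∑ x, ∑ y, (∑ w, (s x w - blockAverage κ s x w) * (s y w - blockAverage κ s y w)) ^ 2 ≤
          η * (Fintype.card V : ℝ) ^ 4 := by
  -- Each refinement gains `η² |V|²` in energy, which never exceeds `|V|²`.
  obtain ⟨T, hT⟩ := exists_nat_gt (1 / η ^ 2)
  refine ⟨4 ^ T, fun V _ s hs => ?_⟩
  by_contra! hcon
  have hs0 : ∀ a b, 0 ≤ s a b := fun a b => by rcases hs a b with h | h <;> simp [h]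
  have hs1 : ∀ a b, s a b ≤ 1 := fun a b => by rcases hs a b with h | h <;> simp [h]
  have key : ∀ j ≤ T, ∃ κ : V → Fin (4 ^ j),
      j * (η ^ 2 * (Fintype.card V : ℝ) ^ 2) ≤ ∑ a, ∑ b, blockAverage κ s a b ^ 2 := by
    intro j
    induction j with
    | zero =>
      intro _
      exact ⟨fun _ => 0, by simpa using sum_nonneg fun a _ => sum_nonneg fun b _ => sq_nonneg _⟩
    | succ j ih =>
      intro hj
      obtain ⟨κ, hκ⟩ := ih (by omega)
      obtain ⟨κ', hκ'⟩ := exists_refinement κ s hs hη.le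
        (hcon _ (Nat.pow_le_pow_right (by norm_num) (by omega)) κ)
      refine ⟨κ', le_trans ?_ hκ'⟩
      push_cast
      linarith
  obtain ⟨κ, hκ⟩ := key T le_rfl
  have hle : ∑ a, ∑ b, blockAverage κ s a b ^ 2 ≤ 1 * (Fintype.card V : ℝ) ^ 2 :=
    sum_sum_le_card_sq _ _ fun a b =>
      pow_le_one₀ (blockAverage_nonneg κ s hs0 a b) (blockAverage_le_one κ s hs1 a b)
  -- Needed only for `V` to be nonempty: the strict inequality fails on an empty type.
  have hbig := hcon _ le_rfl κ
  have hN : 0 < (Fintype.card V : ℝ) := by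
    rcases isEmpty_or_nonempty V with hV | hV
    · simp at hbig
    · exact_mod_cast Fintype.card_pos
  rw [div_lt_iff₀ (by positivity)] at hT
  nlinarith [mul_lt_mul_of_pos_right hT (pow_pos hN 2)]

end BergeGirth

/-! ### Counting in graphs without four-cycles. -/

namespace BergeGirth

open Finset
open scoped Classical in
/-- The `0`-`1` adjacency kernel of a graph. -/
noncomputable def adjKernel {V : Type*} (G : SimpleGraph V) (x y : V) : ℝ :=
  if G.Adj x y then 1 else 0

open scoped Classical in
/-- The `0`-`1` kernel of the pairs of distinct vertices with a common neighbour. -/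
noncomputable def cherryKernel {V : Type*} (G : SimpleGraph V) (x y : V) : ℝ :=
  if x ≠ y ∧ ∃ u, G.Adj x u ∧ G.Adj u y then 1 else 0

/-- The degree of a vertex, as a real number. -/
noncomputable def realDegree {V : Type*} [Fintype V] (G : SimpleGraph V) (x : V) : ℝ :=
  ∑ y, adjKernel G x y

/-- `G` has no cycle of length four. -/
def FourCycleFree {V : Type*} (G : SimpleGraph V) : Prop :=
  ∀ x y u v, x ≠ y → G.Adj x u → G.Adj u y → G.Adj x v → G.Adj v y → u = v

/-- `G` has no cycle of length five. -/
def FiveCycleFree {V : Type*} (G : SimpleGraph V) : Prop :=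
  ∀ v₀ v₁ v₂ v₃ v₄, G.Adj v₀ v₁ → G.Adj v₁ v₂ → G.Adj v₂ v₃ → G.Adj v₃ v₄ → G.Adj v₄ v₀ →
    v₀ ≠ v₂ → v₀ ≠ v₃ → v₁ ≠ v₃ → v₁ ≠ v₄ → v₂ ≠ v₄ → False

section Kernels

variable {V : Type*} (G : SimpleGraph V)

lemma adjKernel_eq (x y : V) : adjKernel G x y = 0 ∨ adjKernel G x y = 1 := by
  unfold adjKernel; split_ifs <;> simp

lemma cherryKernel_eq (x y : V) : cherryKernel G x y = 0 ∨ cherryKernel G x y = 1 := by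
  unfold cherryKernel; split_ifs <;> simp

lemma adjKernel_nonneg (x y : V) : 0 ≤ adjKernel G x y := by
  rcases adjKernel_eq G x y with h | h <;> simp [h]

lemma adjKernel_le_one (x y : V) : adjKernel G x y ≤ 1 := by
  rcases adjKernel_eq G x y with h | h <;> simp [h]

lemma cherryKernel_nonneg (x y : V) : 0 ≤ cherryKernel G x y := by
  rcases cherryKernel_eq G x y with h | h <;> simp [h]

lemma cherryKernel_le_one (x y : V) : cherryKernel G x y ≤ 1 := by
  rcases cherryKernel_eq G x y with h | h <;> simp [h]

lemma adjKernel_symm (x y : V) : adjKernel G x y = adjKernel G y x := by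
  unfold adjKernel
  by_cases h : G.Adj x y
  · rw [if_pos h, if_pos h.symm]
  · rw [if_neg h, if_neg fun h' => h h'.symm]

lemma adjKernel_self (x : V) : adjKernel G x x = 0 := by simp [adjKernel]

lemma cherryKernel_self (x : V) : cherryKernel G x x = 0 := by simp [cherryKernel]

lemma cherryKernel_symm (x y : V) : cherryKernel G x y = cherryKernel G y x := by
  have : (x ≠ y ∧ ∃ u, G.Adj x u ∧ G.Adj u y) ↔ (y ≠ x ∧ ∃ u, G.Adj y u ∧ G.Adj u x) := by
    constructor <;> rintro ⟨h, u, h1, h2⟩ <;> exact ⟨h.symm, u, h2.symm, h1.symm⟩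
  unfold cherryKernel
  by_cases h : x ≠ y ∧ ∃ u, G.Adj x u ∧ G.Adj u y
  · rw [if_pos h, if_pos (this.1 h)]
  · rw [if_neg h, if_neg fun h' => h (this.2 h')]

lemma realDegree_nonneg [Fintype V] (x : V) : 0 ≤ realDegree G x :=
  sum_nonneg fun y _ => adjKernel_nonneg G x y

end Kernels

section FourCycleFree

variable {V : Type*} [Fintype V] {G : SimpleGraph V}

-- A common neighbour of two distinct vertices is unique. This identity is what makes dense methods
-- available for a sparse graph.
open scoped Classical in
lemma sum_adj_mul_adj (h4 : FourCycleFree G) (x y : V) :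
    ∑ u, adjKernel G x u * adjKernel G u y =
      cherryKernel G x y + if x = y then realDegree G x else 0 := by
  by_cases hxy : x = y
  · subst hxy
    rw [cherryKernel_self, if_pos rfl, zero_add]
    refine sum_congr rfl fun u _ => ?_
    rw [adjKernel_symm G u x]
    rcases adjKernel_eq G x u with h | h <;> simp [h]
  · rw [if_neg hxy, add_zero]
    by_cases hu : ∃ u, G.Adj x u ∧ G.Adj u y
    · obtain ⟨u, h1, h2⟩ := hu
      rw [sum_eq_single u]
      · unfold adjKernel cherryKernel
        rw [if_pos h1, if_pos h2, if_pos ⟨hxy, u, h1, h2⟩, one_mul]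
      · intro v _ hv
        by_contra hne
        have h3 : G.Adj x v := by
          by_contra h; exact hne (by simp [adjKernel, h])
        have h4' : G.Adj v y := by
          by_contra h; exact hne (by simp [adjKernel, h])
        exact hv (h4 x y v u hxy h3 h4' h1 h2)
      · simp
    · have : cherryKernel G x y = 0 := by simp only [cherryKernel]; rw [if_neg (fun h => hu h.2)]
      rw [this]
      refine sum_eq_zero fun u _ => ?_
      by_contra hne
      refine hu ⟨u, ?_, ?_⟩ <;> by_contra h <;> exact hne (by simp [adjKernel, h])

lemma sum_adj_mul_adj_le_one (h4 : FourCycleFree G) {x y : V} (hxy : x ≠ y) :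
    ∑ u, adjKernel G x u * adjKernel G u y ≤ 1 := by
  rw [sum_adj_mul_adj h4, if_neg hxy, add_zero]
  exact cherryKernel_le_one G x y

/-- Summation over the cherries of a `C₄`-free graph. -/
lemma sum_cherries (h4 : FourCycleFree G) (h : V → V → ℝ) :
    ∑ y, ∑ w, (∑ x, adjKernel G y x * adjKernel G x w) * h y w =
      ∑ y, ∑ w, cherryKernel G y w * h y w + ∑ y, realDegree G y * h y y := by
  classical
  simp_rw [sum_adj_mul_adj h4, add_mul, sum_add_distrib]
  congr 1
  refine sum_congr rfl fun y _ => ?_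
  simp [ite_mul]

/-- Walks of length two, counted by their middle vertex and by their ends. -/
lemma sum_realDegree_sq_eq (h4 : FourCycleFree G) :
    ∑ x, realDegree G x ^ 2 = ∑ y, ∑ w, cherryKernel G y w + ∑ y, realDegree G y := by
  have h := sum_cherries h4 fun _ _ => 1
  simp only [mul_one] at h
  rw [← h]
  simp_rw [sq, realDegree, sum_mul_sum]
  rw [sum_comm]
  refine sum_congr rfl fun y _ => ?_
  rw [sum_comm]
  exact sum_congr rfl fun w _ => sum_congr rfl fun x _ => by rw [adjKernel_symm G x y]

/-- The linear term is absorbed through `d ≤ (d² + 1) / 2`. -/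
lemma sum_realDegree_sq_le (h4 : FourCycleFree G) :
    ∑ x, realDegree G x ^ 2 ≤ 3 * (Fintype.card V : ℝ) ^ 2 := by
  have h1 := sum_realDegree_sq_eq h4
  have h2 := sum_sum_le_card_sq (cherryKernel G) 1 (cherryKernel_le_one G)
  have h3 : ∑ y, realDegree G y ≤ ∑ y, (realDegree G y ^ 2 / 2 + 1 / 2) :=
    sum_le_sum fun y _ => by nlinarith [sq_nonneg (realDegree G y - 1)]
  rw [sum_add_distrib, ← sum_div] at h3
  have h4 : (Fintype.card V : ℝ) ≤ (Fintype.card V : ℝ) ^ 2 := by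
    exact_mod_cast Nat.le_self_pow two_ne_zero _
  simp only [sum_const, card_univ, nsmul_eq_mul] at h3
  linarith

/-- Taking `r` as the square root of the number of vertices keeps all exponents integral. By
Cauchy–Schwarz; the 2 stands for `√3`. -/
lemma sum_realDegree_le (h4 : FourCycleFree G) {r : ℝ} (hr : 0 ≤ r)
    (hV : (Fintype.card V : ℝ) = r ^ 2) : ∑ x, realDegree G x ≤ 2 * r ^ 3 := by
  have h1 := sum_realDegree_sq_le h4
  have h2 := sq_sum_le_card_mul_sum_sq (s := (univ : Finset V)) (f := realDegree G)
  rw [card_univ, hV] at h2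
  rw [hV] at h1
  refine le_of_sq_le_sq ?_ (by positivity)
  calc _ ≤ r ^ 2 * (3 * (r ^ 2) ^ 2) := h2.trans (mul_le_mul_of_nonneg_left h1 (by positivity))
    _ ≤ (2 * r ^ 3) ^ 2 := by nlinarith [pow_nonneg hr 6]

/-- In a graph without four- and five-cycles, the pairs of cherries whose ends are joined by an
edge are degenerate. -/
lemma sum_adj_cherry_cherry_le (h4 : FourCycleFree G) (h5 : FiveCycleFree G) :
    ∑ y, ∑ z, ∑ w, adjKernel G y z * cherryKernel G z w * cherryKernel G w y ≤
      3 * ∑ x, realDegree G x ^ 2 := by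
  -- Let `v` and `u` be the middles of the two cherries. The closed walk `y z v w u` is a five-cycle
  -- unless `u = z`, `v = y` or `u = v`; these cases give the three terms in this order.
  have hpt : ∀ y z w, adjKernel G y z * cherryKernel G z w * cherryKernel G w y ≤
      adjKernel G z y * adjKernel G z w + adjKernel G y z * adjKernel G y w +
        ∑ u, adjKernel G u y * adjKernel G u w * (adjKernel G u z * adjKernel G z y) := by
    intro y z w
    have hnn : 0 ≤ ∑ u, adjKernel G u y * adjKernel G u w * (adjKernel G u z * adjKernel G z y) :=
      sum_nonneg fun u _ => mul_nonneg (mul_nonneg (adjKernel_nonneg _ _ _) (adjKernel_nonneg _ _ _))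
        (mul_nonneg (adjKernel_nonneg _ _ _) (adjKernel_nonneg _ _ _))
    have hn1 := mul_nonneg (adjKernel_nonneg G z y) (adjKernel_nonneg G z w)
    have hn2 := mul_nonneg (adjKernel_nonneg G y z) (adjKernel_nonneg G y w)
    by_cases hyz : G.Adj y z
    swap
    · simp only [adjKernel, hyz] at *; simp at *; linarith
    by_cases hzw : z ≠ w ∧ ∃ u, G.Adj z u ∧ G.Adj u w
    swap
    · have : cherryKernel G z w = 0 := by simp only [cherryKernel]; rw [if_neg hzw]
      rw [this]; linarith
    by_cases hwy : w ≠ y ∧ ∃ u, G.Adj w u ∧ G.Adj u y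
    swap
    · have : cherryKernel G w y = 0 := by simp only [cherryKernel]; rw [if_neg hwy]
      rw [this]; linarith
    obtain ⟨hne1, v, hzv, hvw⟩ := hzw
    obtain ⟨hne2, u, hwu, huy⟩ := hwy
    have hl : adjKernel G y z * cherryKernel G z w * cherryKernel G w y ≤ 1 :=
      mul_le_one₀ (mul_le_one₀ (adjKernel_le_one _ _ _) (cherryKernel_nonneg _ _ _)
        (cherryKernel_le_one _ _ _)) (cherryKernel_nonneg _ _ _) (cherryKernel_le_one _ _ _)
    refine hl.trans ?_
    by_cases hvy : v = y
    · subst hvy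
      have : adjKernel G v z * adjKernel G v w = 1 := by simp [adjKernel, hyz, hvw]
      linarith
    by_cases huz : u = z
    · subst huz
      have : adjKernel G u y * adjKernel G u w = 1 := by simp [adjKernel, huy, hwu.symm]
      linarith
    by_cases huv : u = v
    · subst huv
      have h1 : adjKernel G u y * adjKernel G u w * (adjKernel G u z * adjKernel G z y) = 1 := by
        simp [adjKernel, huy, hwu.symm, hzv.symm, hyz.symm]
      have := single_le_sum (f := fun u => adjKernel G u y * adjKernel G u w *
        (adjKernel G u z * adjKernel G z y)) (fun u _ => mul_nonneg (mul_nonneg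
        (adjKernel_nonneg _ _ _) (adjKernel_nonneg _ _ _))
        (mul_nonneg (adjKernel_nonneg _ _ _) (adjKernel_nonneg _ _ _))) (mem_univ u)
      simp only [h1] at this
      linarith
    · exact (h5 y z v w u hyz hzv hvw hwu huy (Ne.symm hvy) hne2.symm hne1 (Ne.symm huz)
        (Ne.symm huv)).elim
  have e1 : ∑ y, ∑ z, ∑ w, adjKernel G z y * adjKernel G z w = ∑ x, realDegree G x ^ 2 := by
    rw [sum_comm]
    exact sum_congr rfl fun z _ => by rw [sq, realDegree, sum_mul_sum]
  have e2 : ∑ y, ∑ z, ∑ w, adjKernel G y z * adjKernel G y w = ∑ x, realDegree G x ^ 2 :=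
    sum_congr rfl fun y _ => by rw [sq, realDegree, sum_mul_sum]
  have e3 : ∑ y, ∑ z, ∑ w, ∑ u, adjKernel G u y * adjKernel G u w *
      (adjKernel G u z * adjKernel G z y) ≤ ∑ x, realDegree G x ^ 2 := by
    calc _ = ∑ y, ∑ w, ∑ u, adjKernel G u y * adjKernel G u w *
          ∑ z, adjKernel G u z * adjKernel G z y := by
          refine sum_congr rfl fun y _ => ?_
          rw [sum_comm]
          refine sum_congr rfl fun w _ => ?_
          rw [sum_comm]
          simp_rw [mul_sum]
      _ ≤ ∑ y, ∑ w, ∑ u, adjKernel G u y * adjKernel G u w := by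
          refine sum_le_sum fun y _ => sum_le_sum fun w _ => sum_le_sum fun u _ => ?_
          by_cases huy : u = y
          · subst huy; simp [adjKernel_self]
          · exact mul_le_of_le_one_right (mul_nonneg (adjKernel_nonneg _ _ _)
              (adjKernel_nonneg _ _ _)) (sum_adj_mul_adj_le_one h4 huy)
      _ = ∑ y, ∑ u, ∑ w, adjKernel G u y * adjKernel G u w :=
          sum_congr rfl fun y _ => sum_comm
      _ = _ := e1
  calc _ ≤ ∑ y, ∑ z, ∑ w, (adjKernel G z y * adjKernel G z w + adjKernel G y z * adjKernel G y w +
        ∑ u, adjKernel G u y * adjKernel G u w * (adjKernel G u z * adjKernel G z y)) :=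
        sum_le_sum fun y _ => sum_le_sum fun z _ => sum_le_sum fun w _ => hpt y z w
    _ ≤ _ := by
        simp_rw [sum_add_distrib]
        rw [e1, e2]
        linarith

/-- Replacing a cherry kernel by a kernel close to it in the four-cycle norm changes a weighted
count of closed walks only slightly. -/
lemma sq_sum_adj_mul_le (h4 : FourCycleFree G) (D B : V → V → ℝ) (hD : ∀ a b, |D a b| ≤ 1)
    (hB : ∀ a b, |B a b| ≤ 1) {η : ℝ} (hη : 0 ≤ η)
    (h : ∑ x, ∑ y, (∑ w, D x w * D y w) ^ 2 ≤ η ^ 2 * (Fintype.card V : ℝ) ^ 4) :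
    (∑ y, ∑ z, ∑ w, adjKernel G y z * D z w * B w y) ^ 2 ≤
      (Fintype.card V : ℝ) ^ 2 * (η * (Fintype.card V : ℝ) ^ 3 +
        (Fintype.card V : ℝ) * ∑ x, realDegree G x) := by
  set N : ℝ := (Fintype.card V : ℝ) with hN
  have hN0 : 0 ≤ N := Nat.cast_nonneg _
  have e1 : ∑ y, ∑ z, ∑ w, adjKernel G y z * D z w * B w y =
      ∑ y, ∑ w, (∑ z, adjKernel G y z * D z w) * B w y := by
    refine sum_congr rfl fun y _ => ?_
    rw [sum_comm]
    simp_rw [sum_mul]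
  -- Cauchy–Schwarz over `(y, w)` will discard `B`. Opening the remaining square produces two-step
  -- walks `z y z'`, so that `sum_cherries` trades the sparse kernel for a bounded one.
  have e2 : ∑ y, ∑ w, (∑ z, adjKernel G y z * D z w) ^ 2 =
      ∑ z, ∑ z', (∑ y, adjKernel G z y * adjKernel G y z') * ∑ w, D z w * D z' w := by
    calc _ = ∑ y, ∑ w, ∑ z, ∑ z', adjKernel G y z * D z w * (adjKernel G y z' * D z' w) := by
          simp_rw [sq, sum_mul_sum]
      _ = ∑ y, ∑ z, ∑ z', ∑ w, adjKernel G y z * D z w * (adjKernel G y z' * D z' w) := by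
          refine sum_congr rfl fun y _ => ?_
          rw [sum_comm]
          exact sum_congr rfl fun z _ => sum_comm
      _ = ∑ z, ∑ z', ∑ y, ∑ w, adjKernel G y z * D z w * (adjKernel G y z' * D z' w) := by
          rw [sum_comm]
          exact sum_congr rfl fun z _ => sum_comm
      _ = _ := by
          refine sum_congr rfl fun z _ => sum_congr rfl fun z' _ => ?_
          rw [sum_mul_sum]
          refine sum_congr rfl fun y _ => sum_congr rfl fun w _ => ?_
          rw [adjKernel_symm G z y]
          ring
  have hDD : ∀ z, ∑ w, D z w * D z w ≤ N := by
    intro z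
    calc _ ≤ ∑ w : V, (1 : ℝ) := sum_le_sum fun w _ => by
          rw [← sq, sq_le_one_iff_abs_le_one]; exact hD z w
      _ = N := by simp [hN]
  -- A second Cauchy–Schwarz leaves exactly the four-cycle norm of `D`.
  have h1 : ∑ z, ∑ z', cherryKernel G z z' * ∑ w, D z w * D z' w ≤ η * N ^ 3 := by
    have hcs := sum_sum_mul_sq_le (cherryKernel G) fun z z' => ∑ w, D z w * D z' w
    have hs := sum_sum_le_card_sq (fun a b => cherryKernel G a b ^ 2) 1
      fun a b => pow_le_one₀ (cherryKernel_nonneg G a b) (cherryKernel_le_one G a b)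
    refine le_of_sq_le_sq (hcs.trans ?_) (by positivity)
    calc _ ≤ (1 * N ^ 2) * (η ^ 2 * N ^ 4) := mul_le_mul hs h
          (sum_nonneg fun _ _ => sum_nonneg fun _ _ => sq_nonneg _) (by positivity)
      _ = _ := by ring
  have h2 : ∑ z, realDegree G z * ∑ w, D z w * D z w ≤ N * ∑ x, realDegree G x := by
    rw [mul_sum]
    exact sum_le_sum fun z _ => by
      rw [mul_comm]; exact mul_le_mul_of_nonneg_right (hDD z) (realDegree_nonneg G z)
  have h3 : ∑ y, ∑ w, (∑ z, adjKernel G y z * D z w) ^ 2 ≤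
      η * N ^ 3 + N * ∑ x, realDegree G x := by
    rw [e2, sum_cherries h4]
    linarith
  have hcs := sum_sum_mul_sq_le (fun y w => ∑ z, adjKernel G y z * D z w) fun y w => B w y
  have hBB := sum_sum_le_card_sq (fun a b => B b a ^ 2) 1 fun a b => by
    rw [sq_le_one_iff_abs_le_one]; exact hB b a
  rw [e1]
  calc _ ≤ _ := hcs
    _ ≤ (η * N ^ 3 + N * ∑ x, realDegree G x) * (1 * N ^ 2) := by
        refine mul_le_mul h3 hBB (sum_nonneg fun _ _ => sum_nonneg fun _ _ => sq_nonneg _) ?_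
        have := sum_nonneg fun x (_ : x ∈ (univ : Finset V)) => realDegree_nonneg G x
        positivity
    _ = _ := by ring

/-- The weighted number of edges into a small set of vertices is small. -/
lemma sq_sum_mul_adj_le (h4 : FourCycleFree G) (m : V → ℝ) (hm : ∀ x, 0 ≤ m x)
    (Y : Finset V) :
    (∑ x, ∑ w ∈ Y, m x * adjKernel G x w) ^ 2 ≤
      (#Y : ℝ) * ((∑ x, m x) ^ 2 + ∑ x, m x ^ 2 * realDegree G x) := by
  -- After Cauchy–Schwarz over `w ∈ Y`, the squares count weighted two-step walks: cherries, with
  -- kernel at most 1, and a diagonal of degrees.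
  rw [sum_comm]
  refine (sq_sum_le_card_mul_sum_sq (s := Y)).trans
    (mul_le_mul_of_nonneg_left ?_ (Nat.cast_nonneg _))
  calc ∑ w ∈ Y, (∑ x, m x * adjKernel G x w) ^ 2 ≤ ∑ w, (∑ x, m x * adjKernel G x w) ^ 2 :=
        sum_le_sum_of_subset_of_nonneg (subset_univ _) fun _ _ _ => sq_nonneg _
    _ = ∑ x, ∑ x', (∑ w, adjKernel G x w * adjKernel G w x') * (m x * m x') := by
        simp_rw [sq, sum_mul_sum]
        rw [sum_comm]
        refine sum_congr rfl fun x _ => ?_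
        rw [sum_comm]
        refine sum_congr rfl fun x' _ => ?_
        rw [sum_mul]
        refine sum_congr rfl fun w _ => ?_
        rw [adjKernel_symm G w x']
        ring
    _ = ∑ x, ∑ x', cherryKernel G x x' * (m x * m x') + ∑ x, realDegree G x * (m x * m x) :=
        sum_cherries h4 _
    _ ≤ _ := by
        refine add_le_add ?_ (le_of_eq (sum_congr rfl fun x _ => by ring))
        rw [sq, sum_mul_sum]
        exact sum_le_sum fun x _ => sum_le_sum fun y _ => mul_le_of_le_one_left
          (mul_nonneg (hm x) (hm y)) (cherryKernel_le_one G x y)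

end FourCycleFree

end BergeGirth

/-! ### Triangles, and the lower bound for the averaged count. -/

namespace BergeGirth

open Finset

lemma sum_comm_rotate {I J X : Type*} [Fintype I] [Fintype J] [Fintype X] (f : I → J → X → ℝ) :
    ∑ i, ∑ j, ∑ x, f i j x = ∑ x, ∑ i, ∑ j, f i j x :=
  (sum_congr rfl fun _ _ => sum_comm).trans sum_comm

section Triangles

variable {V : Type*} {G : SimpleGraph V}

/-- The `0`-`1` kernel of the ordered triangles of a graph. -/
noncomputable def triangleKernel {V : Type*} (G : SimpleGraph V) (x y z : V) : ℝ :=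
  adjKernel G x y * adjKernel G y z * adjKernel G z x

lemma triangleKernel_nonneg (x y z : V) : 0 ≤ triangleKernel G x y z :=
  mul_nonneg (mul_nonneg (adjKernel_nonneg _ _ _) (adjKernel_nonneg _ _ _)) (adjKernel_nonneg _ _ _)

lemma triangleKernel_swap (x y z : V) : triangleKernel G x y z = triangleKernel G x z y := by
  unfold triangleKernel
  rw [adjKernel_symm G x y, adjKernel_symm G y z, adjKernel_symm G z x]
  ring

lemma triangleKernel_rotate (x y z : V) : triangleKernel G x y z = triangleKernel G y z x := by
  unfold triangleKernel
  ring

variable [Fintype V]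

/-- An edge lies in at most one triangle, since two apexes would form a four-cycle with its ends. -/
lemma sum_triangleKernel_le (h4 : FourCycleFree G) (x y : V) :
    ∑ z, triangleKernel G x y z ≤ adjKernel G x y := by
  simp_rw [triangleKernel, mul_assoc, ← mul_sum]
  by_cases hxy : y = x
  · subst hxy; simp [adjKernel_self]
  · exact mul_le_of_le_one_right (adjKernel_nonneg _ _ _) (sum_adj_mul_adj_le_one h4 hxy)

lemma sum_sum_triangleKernel_le (h4 : FourCycleFree G) (x : V) :
    ∑ y, ∑ z, triangleKernel G x y z ≤ realDegree G x :=
  sum_le_sum fun y _ => sum_triangleKernel_le h4 x y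

/-- The vertex `z` is determined by `x` and `y`, so the sum runs over two-step walks `y x w`; those
with `w = y` give the degree term. -/
lemma sum_triangle_mul_adj_le (h4 : FourCycleFree G) (ρ : V → V → ℝ) (h0 : ∀ y w, 0 ≤ ρ y w)
    (h1 : ∀ y w, ρ y w ≤ 1) :
    ∑ x, ∑ y, ∑ z, triangleKernel G x y z * ∑ w, adjKernel G x w * ρ y w ≤
      ∑ y, ∑ w, cherryKernel G y w * ρ y w + ∑ x, realDegree G x := by
  calc _ ≤ ∑ x, ∑ y, adjKernel G x y * ∑ w, adjKernel G x w * ρ y w := by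
        refine sum_le_sum fun x _ => sum_le_sum fun y _ => ?_
        rw [← sum_mul]
        exact mul_le_mul_of_nonneg_right (sum_triangleKernel_le h4 x y)
          (sum_nonneg fun w _ => mul_nonneg (adjKernel_nonneg _ _ _) (h0 _ _))
    _ = ∑ y, ∑ w, (∑ x, adjKernel G y x * adjKernel G x w) * ρ y w := by
        rw [sum_comm]
        refine sum_congr rfl fun y _ => ?_
        simp_rw [mul_sum]
        rw [sum_comm]
        refine sum_congr rfl fun w _ => ?_
        rw [sum_mul]
        exact sum_congr rfl fun x _ => by rw [adjKernel_symm G x y]; ring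
    _ = _ := sum_cherries h4 ρ
    _ ≤ _ := by
        gcongr with x _
        exact mul_le_of_le_one_right (realDegree_nonneg G x) (h1 x x)

open scoped Classical in
/-- Few cherries have their ends in blocks of small density. -/
lemma sum_cherry_sparse_le {ι : Type*} [DecidableEq ι] (κ : V → ι) {c : ℝ} :
    ∑ y, ∑ w, cherryKernel G y w * (if blockAverage κ (cherryKernel G) y w < c then 1 else 0) ≤
      max c 0 * (Fintype.card V : ℝ) ^ 2 := by
  -- The indicator of sparse blocks is constant on blocks, so the kernel may be replaced by its
  -- average, which is below `c` there.
  rw [← sum_blockAverage_mul κ (cherryKernel G)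
    (fun y w => if blockAverage κ (cherryKernel G) y w < c then 1 else 0)]
  · refine sum_sum_le_card_sq _ _ fun a b => ?_
    split_ifs with h
    · rw [mul_one]; exact h.le.trans (le_max_left _ _)
    · simp
  · intro a a' b b' ha hb
    simp only [blockAverage_congr κ (cherryKernel G) ha hb]

/-- Vertices of large degree carry few ordered triangles. -/
lemma sum_triangle_large_degree_le (h4 : FourCycleFree G) {D : ℝ} (hD : 0 < D) :
    ∑ x, (if realDegree G x ≤ D then 0 else ∑ y, ∑ z, triangleKernel G x y z) ≤
      3 * (Fintype.card V : ℝ) ^ 2 / D := by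
  refine le_trans ?_ (div_le_div_of_nonneg_right (sum_realDegree_sq_le h4) hD.le)
  rw [sum_div]
  refine sum_le_sum fun x _ => ?_
  split_ifs with h
  · positivity
  · refine (sum_sum_triangleKernel_le h4 x).trans ?_
    rw [le_div_iff₀ hD, sq]
    exact mul_le_mul_of_nonneg_left (not_le.1 h).le (realDegree_nonneg G x)

open scoped Classical in
/-- The contribution of small sets `Y y z` that depend only on the colours of `y` and `z`. -/
lemma sum_small_sets_le (h4 : FourCycleFree G) {k : ℕ} (κ : V → Fin k) (F : V → V → V → ℝ)
    (hF0 : ∀ x y z, 0 ≤ F x y z) {r M g : ℝ} (hr : 0 < r) (hM : 0 < M) (hg : 0 ≤ g)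
    (hV : (Fintype.card V : ℝ) = r ^ 2) (hF1 : ∀ x, ∑ y, ∑ z, F x y z ≤ realDegree G x)
    (hF2 : ∀ x, ∑ y, ∑ z, F x y z ≤ M * r) (hk : 3 * M * (k : ℝ) ^ 4 ≤ r)
    (Y : V → V → Finset V) (hY : ∀ y y' z z', κ y = κ y' → κ z = κ z' → Y y z = Y y' z') :
    ∑ x, ∑ y, ∑ z, F x y z *
      (if (#(Y y z) : ℝ) ≤ g ^ 2 * r ^ 2 then ∑ w ∈ Y y z, adjKernel G x w else 0) ≤
        3 * g * r ^ 4 := by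
  have hk0 : (0 : ℝ) < k := by
    have hVpos : 0 < Fintype.card V := by
      have : (0 : ℝ) < Fintype.card V := by rw [hV]; positivity
      exact_mod_cast this
    obtain ⟨v⟩ := Fintype.card_pos_iff.1 hVpos
    exact_mod_cast (κ v).pos
  -- The weight at `x` with `y`, `z` of colours `i`, `j`. For fixed colours `Y y z` is a single set,
  -- to which `sq_sum_mul_adj_le` applies.
  set m : Fin k → Fin k → V → ℝ := fun i j x =>
    ∑ y, ∑ z, if κ y = i ∧ κ z = j then F x y z else 0 with hm
  have hm0 : ∀ i j x, 0 ≤ m i j x := fun i j x =>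
    sum_nonneg fun y _ => sum_nonneg fun z _ => by split_ifs <;> simp [hF0]
  have hmF : ∀ i j x, m i j x ≤ ∑ y, ∑ z, F x y z := fun i j x =>
    sum_le_sum fun y _ => sum_le_sum fun z _ => by split_ifs <;> simp [hF0]
  have hms : ∀ x, ∑ i, ∑ j, m i j x = ∑ y, ∑ z, F x y z := by
    intro x
    simp only [hm]
    calc _ = ∑ y, ∑ z, ∑ i, ∑ j, if κ y = i ∧ κ z = j then F x y z else 0 := by
          rw [sum_comm_rotate]
          refine sum_congr rfl fun y _ => ?_
          rw [sum_comm_rotate]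
      _ = _ := by
          refine sum_congr rfl fun y _ => sum_congr rfl fun z _ => ?_
          simp [ite_and]
  have hblock : ∀ i j, ∑ x, ∑ y, ∑ z, (if κ y = i ∧ κ z = j then F x y z else 0) *
      (if (#(Y y z) : ℝ) ≤ g ^ 2 * r ^ 2 then ∑ w ∈ Y y z, adjKernel G x w else 0) ≤
        g * r * (∑ x, m i j x + r ^ 3 / (k : ℝ) ^ 2) := by
    intro i j
    have hrhs : 0 ≤ g * r * (∑ x, m i j x + r ^ 3 / (k : ℝ) ^ 2) := by
      have := sum_nonneg fun x (_ : x ∈ (univ : Finset V)) => hm0 i j x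
      positivity
    by_cases hex : ∃ y z, κ y = i ∧ κ z = j ∧ (#(Y y z) : ℝ) ≤ g ^ 2 * r ^ 2
    · obtain ⟨y₀, z₀, hy₀, hz₀, hsm⟩ := hex
      have e1 : ∑ x, ∑ y, ∑ z, (if κ y = i ∧ κ z = j then F x y z else 0) *
          (if (#(Y y z) : ℝ) ≤ g ^ 2 * r ^ 2 then ∑ w ∈ Y y z, adjKernel G x w else 0) =
          ∑ x, ∑ w ∈ Y y₀ z₀, m i j x * adjKernel G x w := by
        refine sum_congr rfl fun x _ => ?_
        rw [← mul_sum]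
        simp only [hm]
        rw [sum_mul]
        refine sum_congr rfl fun y _ => ?_
        rw [sum_mul]
        refine sum_congr rfl fun z _ => ?_
        by_cases hyz : κ y = i ∧ κ z = j
        · rw [hY y y₀ z z₀ (hyz.1.trans hy₀.symm) (hyz.2.trans hz₀.symm), if_pos hsm]
        · rw [if_neg hyz]; simp
      rw [e1]
      refine le_of_sq_le_sq ((sq_sum_mul_adj_le h4 (m i j) (hm0 i j) (Y y₀ z₀)).trans ?_) hrhs
      have hmd : ∑ x, m i j x ^ 2 * realDegree G x ≤ M * r * (3 * (r ^ 2) ^ 2) := by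
        rw [← hV]
        refine le_trans ?_ (mul_le_mul_of_nonneg_left (sum_realDegree_sq_le h4) (by positivity))
        rw [mul_sum]
        refine sum_le_sum fun x _ => ?_
        have h1 := (hmF i j x).trans (hF1 x)
        have h2 := (hmF i j x).trans (hF2 x)
        calc _ = m i j x * m i j x * realDegree G x := by ring
          _ ≤ (M * r) * realDegree G x * realDegree G x :=
            mul_le_mul_of_nonneg_right (mul_le_mul h2 h1 (hm0 i j x) (by positivity))
              (realDegree_nonneg G x)
          _ = _ := by ring
      -- The degree term fits into an error `r³ / k²` per colour pair, hence `r³` over all `k²`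
      -- pairs; this is the role of `hk`.
      have hlow : M * r * (3 * (r ^ 2) ^ 2) ≤ (r ^ 3 / (k : ℝ) ^ 2) ^ 2 := by
        rw [div_pow, le_div_iff₀ (by positivity)]
        calc _ = (3 * M * (k : ℝ) ^ 4) * r ^ 5 := by ring
          _ ≤ r * r ^ 5 := mul_le_mul_of_nonneg_right hk (by positivity)
          _ = _ := by ring
      have hsum0 := sum_nonneg fun x (_ : x ∈ (univ : Finset V)) => hm0 i j x
      have hq : 0 ≤ r ^ 3 / (k : ℝ) ^ 2 := by positivity
      calc _ ≤ g ^ 2 * r ^ 2 * ((∑ x, m i j x) ^ 2 + (r ^ 3 / (k : ℝ) ^ 2) ^ 2) := by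
            refine mul_le_mul hsm (by linarith) ?_ (by positivity)
            exact add_nonneg (sq_nonneg _) (sum_nonneg fun x _ =>
              mul_nonneg (sq_nonneg _) (realDegree_nonneg G x))
        _ ≤ g ^ 2 * r ^ 2 * (∑ x, m i j x + r ^ 3 / (k : ℝ) ^ 2) ^ 2 := by
            refine mul_le_mul_of_nonneg_left ?_ (by positivity)
            nlinarith [mul_nonneg hsum0 hq]
        _ = _ := by ring
    · refine le_trans (le_of_eq (sum_eq_zero fun x _ => sum_eq_zero fun y _ =>
        sum_eq_zero fun z _ => ?_)) hrhs
      by_cases hyz : κ y = i ∧ κ z = j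
      · rw [if_neg fun h => hex ⟨y, z, hyz.1, hyz.2, h⟩, mul_zero]
      · rw [if_neg hyz, zero_mul]
  calc _ = ∑ i, ∑ j, ∑ x, ∑ y, ∑ z, (if κ y = i ∧ κ z = j then F x y z else 0) *
        (if (#(Y y z) : ℝ) ≤ g ^ 2 * r ^ 2 then ∑ w ∈ Y y z, adjKernel G x w else 0) := by
        refine Eq.trans ?_ (sum_comm_rotate _).symm
        refine sum_congr rfl fun x _ => ?_
        refine Eq.trans ?_ (sum_comm_rotate _).symm
        refine sum_congr rfl fun y _ => ?_
        refine Eq.trans ?_ (sum_comm_rotate _).symm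
        refine sum_congr rfl fun z _ => ?_
        simp_rw [← sum_mul]
        congr 1
        simp [ite_and]
    _ ≤ ∑ i : Fin k, ∑ j : Fin k, g * r * (∑ x, m i j x + r ^ 3 / (k : ℝ) ^ 2) :=
        sum_le_sum fun i _ => sum_le_sum fun j _ => hblock i j
    _ = g * r * (∑ x, ∑ y, ∑ z, F x y z + r ^ 3) := by
        have e1 : ∑ i, ∑ j, ∑ x, m i j x = ∑ x, ∑ y, ∑ z, F x y z := by
          rw [sum_comm_rotate]
          exact sum_congr rfl fun x _ => hms x
        have e2 : ∑ _i : Fin k, ∑ _j : Fin k, r ^ 3 / (k : ℝ) ^ 2 = r ^ 3 := by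
          simp only [sum_const, card_univ, Fintype.card_fin, nsmul_eq_mul]
          field_simp
        simp_rw [← mul_sum, sum_add_distrib]
        rw [e1, e2]
    _ ≤ g * r * (2 * r ^ 3 + r ^ 3) := by
        have := (sum_le_sum fun x (_ : x ∈ (univ : Finset V)) => hF1 x).trans
          (sum_realDegree_le h4 hr.le hV)
        gcongr
    _ = _ := by ring

set_option maxHeartbeats 400000 in
open scoped Classical in
/-- Many triangles force many closed walks through dense blocks of the cherry kernel. -/
lemma le_sum_adj_blockAverage (h4 : FourCycleFree G) {k : ℕ} (κ : V → Fin k)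
    {r ε M g c : ℝ} (hr : 0 < r) (hε : 0 < ε) (hM : M = 6 / ε) (hg : 0 ≤ g) (hc : 0 ≤ c)
    (hV : (Fintype.card V : ℝ) = r ^ 2) (hk : 3 * M * (k : ℝ) ^ 4 ≤ r)
    (hT : ε * r ^ 3 ≤ ∑ x, ∑ y, ∑ z, triangleKernel G x y z) :
    (ε ^ 2 / 4 * r ^ 4 - 2 * c * r ^ 4 - 4 * r ^ 3 - 3 * g * r ^ 4) * (c ^ 2 * (g ^ 2 * r ^ 2)) ≤
      M * r * ∑ y, ∑ z, ∑ w, adjKernel G y z * blockAverage κ (cherryKernel G) z w *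
        blockAverage κ (cherryKernel G) w y := by
  have hM0 : 0 < M := by rw [hM]; positivity
  set s' := blockAverage κ (cherryKernel G) with hs'
  have hs0 : ∀ a b, 0 ≤ s' a b := blockAverage_nonneg κ _ (cherryKernel_nonneg G)
  have hsymm : ∀ a b, s' a b = s' b a := blockAverage_symm κ _ (cherryKernel_symm G)
  set τ := triangleKernel G with hτ
  have hτ0 : ∀ x y z, 0 ≤ τ x y z := triangleKernel_nonneg
  -- Truncation at degree `M r` with `M = 6 / ε` loses at most `3 r⁴ / (M r) = ε r³ / 2`.
  set F : V → V → V → ℝ := fun x y z => if realDegree G x ≤ M * r then τ x y z else 0 with hF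
  have hF0 : ∀ x y z, 0 ≤ F x y z := fun x y z => by
    simp only [hF]; split_ifs <;> simp [hτ0]
  have hFτ : ∀ x y z, F x y z ≤ τ x y z := fun x y z => by
    simp only [hF]; split_ifs <;> simp [hτ0]
  have hF1 : ∀ x, ∑ y, ∑ z, F x y z ≤ realDegree G x := fun x =>
    (sum_le_sum fun y _ => sum_le_sum fun z _ => hFτ x y z).trans (sum_sum_triangleKernel_le h4 x)
  have hF2 : ∀ x, ∑ y, ∑ z, F x y z ≤ M * r := fun x => by
    by_cases h : realDegree G x ≤ M * r
    · exact (hF1 x).trans h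
    · simp only [hF, if_neg h, sum_const_zero]; positivity
  set Y : V → V → Finset V := fun y z => {w | c ≤ s' y w ∧ c ≤ s' z w} with hYdef
  have hY : ∀ y y' z z', κ y = κ y' → κ z = κ z' → Y y z = Y y' z' := by
    intro y y' z z' hy hz
    ext w
    simp only [hYdef, mem_filter, mem_univ, true_and]
    rw [hs', blockAverage_congr κ _ hy rfl, blockAverage_congr κ _ hz rfl]
  -- the total weight
  have hF3 : ε / 2 * r ^ 3 ≤ ∑ x, ∑ y, ∑ z, F x y z := by
    have h1 := sum_triangle_large_degree_le h4 (show 0 < M * r by positivity)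
    have h2 : ∑ x, ∑ y, ∑ z, τ x y z = ∑ x, ∑ y, ∑ z, F x y z +
        ∑ x, (if realDegree G x ≤ M * r then 0 else ∑ y, ∑ z, τ x y z) := by
      rw [← sum_add_distrib]
      refine sum_congr rfl fun x _ => ?_
      by_cases h : realDegree G x ≤ M * r <;> simp [hF, h]
    have h3 : 3 * (Fintype.card V : ℝ) ^ 2 / (M * r) = ε / 2 * r ^ 3 := by
      rw [hV, hM]; field_simp; norm_num
    rw [h3] at h1
    linarith
  -- The weight at `x` is at most its degree, so its square bounds the summand from below; then
  -- Cauchy–Schwarz over `x`.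
  have htotal : ε ^ 2 / 4 * r ^ 4 ≤ ∑ x, ∑ y, ∑ z, F x y z * realDegree G x := by
    have h1 := sq_sum_le_card_mul_sum_sq (s := (univ : Finset V))
      (f := fun x => ∑ y, ∑ z, F x y z)
    rw [card_univ, hV] at h1
    have h2 : ∑ x, (∑ y, ∑ z, F x y z) ^ 2 ≤ ∑ x, ∑ y, ∑ z, F x y z * realDegree G x := by
      refine sum_le_sum fun x _ => ?_
      simp_rw [← sum_mul]
      rw [sq]
      exact mul_le_mul_of_nonneg_left (hF1 x)
        (sum_nonneg fun y _ => sum_nonneg fun z _ => hF0 x y z)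
    have h3 : (ε / 2 * r ^ 3) ^ 2 ≤ (∑ x, ∑ y, ∑ z, F x y z) ^ 2 :=
      pow_le_pow_left₀ (by positivity) hF3 2
    have h4 : r ^ 2 * (ε ^ 2 / 4 * r ^ 4) ≤ r ^ 2 * ∑ x, ∑ y, ∑ z, F x y z * realDegree G x := by
      calc _ = (ε / 2 * r ^ 3) ^ 2 := by ring
        _ ≤ _ := h3.trans (h1.trans (mul_le_mul_of_nonneg_left h2 (by positivity)))
    exact le_of_mul_le_mul_left h4 (by positivity)
  -- the neighbours of `x` in sparse position
  have hrare : ∑ x, ∑ y, ∑ z, τ x y z * ∑ w, adjKernel G x w * (if s' y w < c then 1 else 0) ≤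
      c * r ^ 4 + 2 * r ^ 3 := by
    refine (sum_triangle_mul_adj_le h4 _ (fun y w => by split_ifs <;> simp)
      (fun y w => by split_ifs <;> simp)).trans (add_le_add ?_ (sum_realDegree_le h4 hr.le hV))
    refine (sum_cherry_sparse_le κ).trans (le_of_eq ?_)
    rw [max_eq_left hc, hV]; ring
  have hrare' : ∑ x, ∑ y, ∑ z, τ x y z * ∑ w, adjKernel G x w * (if s' z w < c then 1 else 0) ≤
      c * r ^ 4 + 2 * r ^ 3 := by
    refine le_trans (le_of_eq (sum_congr rfl fun x _ => ?_)) hrare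
    rw [sum_comm]
    exact sum_congr rfl fun z _ => sum_congr rfl fun y _ => by rw [hτ, triangleKernel_swap]
  have hsmall := sum_small_sets_le h4 κ F hF0 hr hM0 hg hV hF1 hF2 hk Y hY
  set big : V → V → ℝ := fun y z => if (#(Y y z) : ℝ) ≤ g ^ 2 * r ^ 2 then 0 else 1 with hbig
  have hbig0 : ∀ y z, 0 ≤ big y z := fun y z => by simp only [hbig]; split_ifs <;> simp
  -- A neighbour `w` of `x` is in a sparse block with `y`, in one with `z`, or in `Y y z`. If `Y y
  -- z` is large, the degree is simply bounded by `M r`.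
  have hpt : ∀ x y z, F x y z * realDegree G x ≤
      τ x y z * ∑ w, adjKernel G x w * (if s' y w < c then 1 else 0) +
      τ x y z * ∑ w, adjKernel G x w * (if s' z w < c then 1 else 0) +
      F x y z * (if (#(Y y z) : ℝ) ≤ g ^ 2 * r ^ 2 then ∑ w ∈ Y y z, adjKernel G x w else 0) +
      M * r * (τ x y z * big y z) := by
    intro x y z
    have ha0 : ∀ w, 0 ≤ adjKernel G x w := adjKernel_nonneg G x
    have hp1 : 0 ≤ ∑ w, adjKernel G x w * (if s' y w < c then 1 else 0) :=
      sum_nonneg fun w _ => mul_nonneg (ha0 w) (by split_ifs <;> simp)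
    have hp2 : 0 ≤ ∑ w, adjKernel G x w * (if s' z w < c then 1 else 0) :=
      sum_nonneg fun w _ => mul_nonneg (ha0 w) (by split_ifs <;> simp)
    by_cases hsm : (#(Y y z) : ℝ) ≤ g ^ 2 * r ^ 2
    · rw [if_pos hsm]
      have hb : big y z = 0 := by simp only [hbig, if_pos hsm]
      have hd : realDegree G x ≤ ∑ w, adjKernel G x w * (if s' y w < c then 1 else 0) +
          ∑ w, adjKernel G x w * (if s' z w < c then 1 else 0) + ∑ w ∈ Y y z, adjKernel G x w := by
        rw [sum_filter, ← sum_add_distrib, ← sum_add_distrib, realDegree]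
        refine sum_le_sum fun w _ => ?_
        have := ha0 w
        by_cases h1 : s' y w < c
        · simp only [if_pos h1]; split_ifs <;> linarith
        · by_cases h2 : s' z w < c
          · simp only [if_pos h2]; split_ifs <;> linarith
          · simp only [if_neg h1, if_neg h2]
            rw [if_pos ⟨not_lt.1 h1, not_lt.1 h2⟩]; linarith
      rw [hb]
      have e1 := mul_le_mul_of_nonneg_left hd (hF0 x y z)
      have e2 := mul_le_mul_of_nonneg_right (hFτ x y z) hp1
      have e3 := mul_le_mul_of_nonneg_right (hFτ x y z) hp2
      rw [mul_add, mul_add] at e1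
      linarith
    · rw [if_neg hsm]
      have hb : big y z = 1 := by simp only [hbig, if_neg hsm]
      rw [hb]
      have e1 : F x y z * realDegree G x ≤ τ x y z * (M * r) := by
        by_cases h : realDegree G x ≤ M * r
        · exact mul_le_mul (hFτ x y z) h (realDegree_nonneg G x) (hτ0 x y z)
        · simp only [hF, if_neg h, zero_mul]
          have := hτ0 x y z
          positivity
      have e2 := mul_nonneg (hτ0 x y z) hp1
      have e3 := mul_nonneg (hτ0 x y z) hp2
      linarith
  have hmain : ε ^ 2 / 4 * r ^ 4 - 2 * c * r ^ 4 - 4 * r ^ 3 - 3 * g * r ^ 4 ≤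
      M * r * ∑ x, ∑ y, ∑ z, τ x y z * big y z := by
    have h1 := htotal.trans (sum_le_sum fun x _ => sum_le_sum fun y _ => sum_le_sum fun z _ =>
      hpt x y z)
    simp_rw [sum_add_distrib, ← mul_sum] at h1
    linarith
  have hedges : ∑ x, ∑ y, ∑ z, τ x y z * big y z ≤ ∑ y, ∑ z, adjKernel G y z * big y z := by
    calc _ = ∑ y, ∑ z, (∑ x, τ y z x) * big y z := by
          rw [sum_comm]
          refine sum_congr rfl fun y _ => ?_
          rw [sum_comm]
          refine sum_congr rfl fun z _ => ?_
          rw [sum_mul]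
          exact sum_congr rfl fun x _ => by rw [hτ, triangleKernel_rotate]
      _ ≤ _ := sum_le_sum fun y _ => sum_le_sum fun z _ =>
          mul_le_mul_of_nonneg_right (sum_triangleKernel_le h4 y z) (hbig0 y z)
  have hlow : ∀ y z, big y z * (c ^ 2 * (g ^ 2 * r ^ 2)) ≤ ∑ w, s' z w * s' w y := by
    intro y z
    have hnn : ∀ w, 0 ≤ s' z w * s' w y := fun w => mul_nonneg (hs0 _ _) (hs0 _ _)
    by_cases hsm : (#(Y y z) : ℝ) ≤ g ^ 2 * r ^ 2
    · simp only [hbig, if_pos hsm, zero_mul]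
      exact sum_nonneg fun w _ => hnn w
    · simp only [hbig, if_neg hsm, one_mul]
      calc c ^ 2 * (g ^ 2 * r ^ 2) ≤ c ^ 2 * #(Y y z) :=
            mul_le_mul_of_nonneg_left (not_le.1 hsm).le (by positivity)
        _ = ∑ w ∈ Y y z, c * c := by simp; ring
        _ ≤ ∑ w ∈ Y y z, s' z w * s' w y := by
            refine sum_le_sum fun w hw => ?_
            simp only [hYdef, mem_filter, mem_univ, true_and] at hw
            rw [hsymm w y]
            exact mul_le_mul hw.2 hw.1 hc (hs0 _ _)
        _ ≤ _ := sum_le_sum_of_subset_of_nonneg (subset_univ _) fun w _ _ => hnn w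
  have hfinal : (∑ y, ∑ z, adjKernel G y z * big y z) * (c ^ 2 * (g ^ 2 * r ^ 2)) ≤
      ∑ y, ∑ z, ∑ w, adjKernel G y z * s' z w * s' w y := by
    simp_rw [sum_mul]
    refine sum_le_sum fun y _ => sum_le_sum fun z _ => ?_
    simp_rw [mul_assoc, ← mul_sum]
    exact mul_le_mul_of_nonneg_left (by simpa [mul_assoc] using hlow y z) (adjKernel_nonneg _ _ _)
  calc _ ≤ (M * r * ∑ y, ∑ z, adjKernel G y z * big y z) * (c ^ 2 * (g ^ 2 * r ^ 2)) :=
        mul_le_mul_of_nonneg_right (hmain.trans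
          (mul_le_mul_of_nonneg_left hedges (by positivity))) (by positivity)
    _ = M * r * ((∑ y, ∑ z, adjKernel G y z * big y z) * (c ^ 2 * (g ^ 2 * r ^ 2))) := by ring
    _ ≤ _ := mul_le_mul_of_nonneg_left hfinal (by positivity)

end Triangles

end BergeGirth

/-! ### The upper bound, and few triangles without four- and five-cycles. -/

namespace BergeGirth

open Finset

/-- The two cherry kernels are exchanged for averages one at a time, each at cost `δ r⁵`, starting
from the degenerate count `O(r⁴)`. -/
lemma sum_adj_blockAverage_le {V ι : Type*} [Fintype V] [DecidableEq ι] {G : SimpleGraph V}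
    (h4 : FourCycleFree G) (h5 : FiveCycleFree G) (κ : V → ι) {r η δ : ℝ} (hr : 0 < r)
    (hη : 0 < η) (hδ : 0 ≤ δ) (hηδ : 2 * η ≤ δ ^ 2) (hV : (Fintype.card V : ℝ) = r ^ 2)
    (hrη : 2 / η ≤ r)
    (hreg : ∑ x, ∑ y, (∑ w, (cherryKernel G x w - blockAverage κ (cherryKernel G) x w) *
      (cherryKernel G y w - blockAverage κ (cherryKernel G) y w)) ^ 2 ≤
        η ^ 2 * (Fintype.card V : ℝ) ^ 4) :
    ∑ y, ∑ z, ∑ w, adjKernel G y z * blockAverage κ (cherryKernel G) z w *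
      blockAverage κ (cherryKernel G) w y ≤ 9 * r ^ 4 + 2 * δ * r ^ 5 := by
  set s := cherryKernel G with hs
  set s' := blockAverage κ s with hs'
  have hs0 : ∀ a b, 0 ≤ s a b := cherryKernel_nonneg G
  have hs1 : ∀ a b, s a b ≤ 1 := cherryKernel_le_one G
  have ht0 : ∀ a b, 0 ≤ s' a b := blockAverage_nonneg κ _ hs0
  have ht1 : ∀ a b, s' a b ≤ 1 := blockAverage_le_one κ _ hs1
  have hssymm : ∀ a b, s a b = s b a := cherryKernel_symm G
  have htsymm : ∀ a b, s' a b = s' b a := blockAverage_symm κ _ hssymm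
  have hD : ∀ a b, |s a b - s' a b| ≤ 1 := fun a b => by
    rw [abs_le]; constructor <;> linarith [hs0 a b, hs1 a b, ht0 a b, ht1 a b]
  have hbound : ∀ B : V → V → ℝ, (∀ a b, |B a b| ≤ 1) →
      |∑ y, ∑ z, ∑ w, adjKernel G y z * (s z w - s' z w) * B w y| ≤ δ * r ^ 5 := by
    intro B hB
    have h := sq_sum_adj_mul_le h4 (fun a b => s a b - s' a b) B hD hB hη.le hreg
    have hdeg := sum_realDegree_le h4 hr.le hV
    refine abs_le_of_sq_le_sq (h.trans ?_) (by positivity)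
    rw [hV]
    rw [div_le_iff₀ hη] at hrη
    calc _ ≤ (r ^ 2) ^ 2 * (η * (r ^ 2) ^ 3 + r ^ 2 * (2 * r ^ 3)) := by gcongr
      _ = r ^ 9 * (η * r + 2) := by ring
      _ ≤ r ^ 9 * (r * (2 * η)) := by gcongr; linarith
      _ ≤ r ^ 9 * (r * δ ^ 2) := by gcongr
      _ = _ := by ring
  have h1 := (abs_le.1 (hbound s fun a b => abs_le.2 ⟨by linarith [hs0 a b], hs1 a b⟩)).1
  have h2 := (abs_le.1 (hbound s' fun a b => abs_le.2 ⟨by linarith [ht0 a b], ht1 a b⟩)).1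
  have h3 := sum_adj_cherry_cherry_le h4 h5
  have h4' := sum_realDegree_sq_le h4
  rw [hV] at h4'
  have hswap : ∑ y, ∑ z, ∑ w, adjKernel G y z * (s z w - s' z w) * s' w y =
      ∑ y, ∑ z, ∑ w, adjKernel G y z * s' z w * (s w y - s' w y) := by
    rw [sum_comm]
    refine sum_congr rfl fun y _ => sum_congr rfl fun z _ => sum_congr rfl fun w _ => ?_
    rw [adjKernel_symm G z y, htsymm w z, hssymm y w, htsymm y w]
    ring
  have hsplit : ∑ y, ∑ z, ∑ w, adjKernel G y z * s' z w * s' w y =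
      ∑ y, ∑ z, ∑ w, adjKernel G y z * s z w * s w y -
      ∑ y, ∑ z, ∑ w, adjKernel G y z * (s z w - s' z w) * s w y -
      ∑ y, ∑ z, ∑ w, adjKernel G y z * s' z w * (s w y - s' w y) := by
    simp_rw [← sum_sub_distrib]
    refine sum_congr rfl fun y _ => sum_congr rfl fun z _ => sum_congr rfl fun w _ => ?_
    ring
  rw [hsplit, ← hswap]
  have : 3 * ∑ x, realDegree G x ^ 2 ≤ 9 * r ^ 4 := by linarith [pow_mul r 2 2]
  linarith

/-- A graph without four- and five-cycles has few triangles. -/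
theorem sum_triangleKernel_lt {ε : ℝ} (hε : 0 < ε) :
    ∃ R : ℝ, ∀ (V : Type) [Fintype V] (G : SimpleGraph V), FourCycleFree G → FiveCycleFree G →
      ∀ r, R ≤ r → (Fintype.card V : ℝ) = r ^ 2 →
        ∑ x, ∑ y, ∑ z, triangleKernel G x y z < ε * r ^ 3 := by
  obtain ⟨M, hM⟩ : ∃ M, M = 6 / ε := ⟨_, rfl⟩
  -- With `r > 64 / ε²`, the losses `2c`, `4 / r` and `3g` total at most `ε² / 8`, half of the main
  -- term.
  obtain ⟨c, hc⟩ : ∃ c, c = ε ^ 2 / 64 := ⟨_, rfl⟩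
  obtain ⟨g, hg⟩ : ∃ g, g = ε ^ 2 / 96 := ⟨_, rfl⟩
  have hM0 : 0 < M := by rw [hM]; positivity
  have hc0 : 0 < c := by rw [hc]; positivity
  have hg0 : 0 < g := by rw [hg]; positivity
  -- The lower bound becomes `β r⁵`. With `δ = β / 4` the upper bound is `9 r⁴ + β r⁵ / 2`, which is
  -- smaller once `r > 18 / β`.
  obtain ⟨β, hβ⟩ : ∃ β, β = ε ^ 2 / 8 * (c ^ 2 * g ^ 2) / M := ⟨_, rfl⟩
  have hβ0 : 0 < β := by rw [hβ]; positivity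
  obtain ⟨η, hη⟩ : ∃ η, η = (β / 4) ^ 2 / 2 := ⟨_, rfl⟩
  have hη0 : 0 < η := by rw [hη]; positivity
  obtain ⟨K, hK⟩ := exists_regular_coloring (show 0 < η ^ 2 by positivity)
  refine ⟨1 + 64 / ε ^ 2 + 2 / η + 18 / β + 3 * M * (K : ℝ) ^ 4, fun V _ G h4 h5 r hR hV => ?_⟩
  have p1 : 0 < 64 / ε ^ 2 := by positivity
  have p2 : 0 < 2 / η := by positivity
  have p3 : 0 < 18 / β := by positivity
  have p4 : 0 ≤ 3 * M * (K : ℝ) ^ 4 := by positivity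
  have hr : 0 < r := by linarith
  by_contra! hT
  obtain ⟨k, hkK, κ, hreg⟩ := hK V (cherryKernel G) (cherryKernel_eq G)
  have hkr : 3 * M * (k : ℝ) ^ 4 ≤ r := by
    have : 3 * M * (k : ℝ) ^ 4 ≤ 3 * M * (K : ℝ) ^ 4 := by gcongr
    linarith
  have hlow := le_sum_adj_blockAverage h4 κ hr hε hM hg0.le hc0.le hV hkr hT
  have hup := sum_adj_blockAverage_le h4 h5 κ hr hη0 (δ := β / 4) (by positivity)
    (by rw [hη]; linarith) hV (by linarith) hreg
  have hr1 : 64 / ε ^ 2 < r := by linarith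
  rw [div_lt_iff₀ (by positivity)] at hr1
  have h1 : ε ^ 2 / 8 * r ^ 4 ≤
      ε ^ 2 / 4 * r ^ 4 - 2 * c * r ^ 4 - 4 * r ^ 3 - 3 * g * r ^ 4 := by
    have := mul_le_mul_of_nonneg_right hr1.le (show 0 ≤ r ^ 3 / 16 by positivity)
    rw [hc, hg]
    linarith
  have h2 : M * r * (β * r ^ 5) ≤ M * r * (9 * r ^ 4 + 2 * (β / 4) * r ^ 5) := by
    calc M * r * (β * r ^ 5) = ε ^ 2 / 8 * r ^ 4 * (c ^ 2 * (g ^ 2 * r ^ 2)) := by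
          rw [hβ]; field_simp
      _ ≤ _ := mul_le_mul_of_nonneg_right h1 (by positivity)
      _ ≤ _ := hlow
      _ ≤ _ := mul_le_mul_of_nonneg_left hup (by positivity)
  have h3 := le_of_mul_le_mul_left h2 (by positivity)
  have hr3 : 18 / β < r := by linarith
  rw [div_lt_iff₀ hβ0] at hr3
  have := mul_lt_mul_of_pos_right hr3 (show 0 < r ^ 4 / 2 by positivity)
  linarith

end BergeGirth

/-! ### Berge cycles and the shadow graph. -/

namespace BergeGirth

open Hypergraph

section Cycles

variable {α : Type*} {H : Hypergraph α}

lemma hasBergeCycle_two {x y : α} {e f : Set α} (he : e ∈ H.edgeSet) (hf : f ∈ H.edgeSet)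
    (hef : e ≠ f) (hxy : x ≠ y) (hxe : x ∈ e) (hye : y ∈ e) (hxf : x ∈ f) (hyf : y ∈ f) :
    H.HasBergeCycle 2 := by
  refine ⟨le_rfl, ![x, y], ![e, f], ?_, ?_, ?_⟩
  · intro i j h; fin_cases i <;> fin_cases j <;> simp_all
  · intro i j h; fin_cases i <;> fin_cases j <;> simp_all
  · intro i
    rw [finRotate_apply]
    fin_cases i <;> simp_all

lemma hasBergeCycle_three {v₀ v₁ v₂ : α} {e₀ e₁ e₂ : Set α} (he₀ : e₀ ∈ H.edgeSet)
    (he₁ : e₁ ∈ H.edgeSet) (he₂ : e₂ ∈ H.edgeSet) (h01 : e₀ ≠ e₁) (h02 : e₀ ≠ e₂) (h12 : e₁ ≠ e₂)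
    (w01 : v₀ ≠ v₁) (w02 : v₀ ≠ v₂) (w12 : v₁ ≠ v₂) (m₀ : v₀ ∈ e₀) (m₀' : v₁ ∈ e₀)
    (m₁ : v₁ ∈ e₁) (m₁' : v₂ ∈ e₁) (m₂ : v₂ ∈ e₂) (m₂' : v₀ ∈ e₂) : H.HasBergeCycle 3 := by
  refine ⟨by norm_num, ![v₀, v₁, v₂], ![e₀, e₁, e₂], ?_, ?_, ?_⟩
  · intro i j h; fin_cases i <;> fin_cases j <;> simp_all
  · intro i j h; fin_cases i <;> fin_cases j <;> simp_all
  · intro i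
    rw [finRotate_apply]
    fin_cases i <;> simp_all

lemma hasBergeCycle_four {v₀ v₁ v₂ v₃ : α} {e₀ e₁ e₂ e₃ : Set α} (he₀ : e₀ ∈ H.edgeSet)
    (he₁ : e₁ ∈ H.edgeSet) (he₂ : e₂ ∈ H.edgeSet) (he₃ : e₃ ∈ H.edgeSet)
    (h01 : e₀ ≠ e₁) (h02 : e₀ ≠ e₂) (h03 : e₀ ≠ e₃) (h12 : e₁ ≠ e₂) (h13 : e₁ ≠ e₃)
    (h23 : e₂ ≠ e₃) (w01 : v₀ ≠ v₁) (w02 : v₀ ≠ v₂) (w03 : v₀ ≠ v₃) (w12 : v₁ ≠ v₂)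
    (w13 : v₁ ≠ v₃) (w23 : v₂ ≠ v₃) (m₀ : v₀ ∈ e₀) (m₀' : v₁ ∈ e₀) (m₁ : v₁ ∈ e₁) (m₁' : v₂ ∈ e₁)
    (m₂ : v₂ ∈ e₂) (m₂' : v₃ ∈ e₂) (m₃ : v₃ ∈ e₃) (m₃' : v₀ ∈ e₃) : H.HasBergeCycle 4 := by
  refine ⟨by norm_num, ![v₀, v₁, v₂, v₃], ![e₀, e₁, e₂, e₃], ?_, ?_, ?_⟩
  · intro i j h; fin_cases i <;> fin_cases j <;> simp_all
  · intro i j h; fin_cases i <;> fin_cases j <;> simp_all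
  · intro i
    rw [finRotate_apply]
    fin_cases i <;> simp_all

lemma hasBergeCycle_five {v₀ v₁ v₂ v₃ v₄ : α} {e₀ e₁ e₂ e₃ e₄ : Set α} (he₀ : e₀ ∈ H.edgeSet)
    (he₁ : e₁ ∈ H.edgeSet) (he₂ : e₂ ∈ H.edgeSet) (he₃ : e₃ ∈ H.edgeSet) (he₄ : e₄ ∈ H.edgeSet)
    (h01 : e₀ ≠ e₁) (h02 : e₀ ≠ e₂) (h03 : e₀ ≠ e₃) (h04 : e₀ ≠ e₄) (h12 : e₁ ≠ e₂) (h13 : e₁ ≠ e₃)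
    (h14 : e₁ ≠ e₄) (h23 : e₂ ≠ e₃) (h24 : e₂ ≠ e₄) (h34 : e₃ ≠ e₄) (w01 : v₀ ≠ v₁) (w02 : v₀ ≠ v₂)
    (w03 : v₀ ≠ v₃) (w04 : v₀ ≠ v₄) (w12 : v₁ ≠ v₂) (w13 : v₁ ≠ v₃) (w14 : v₁ ≠ v₄) (w23 : v₂ ≠ v₃)
    (w24 : v₂ ≠ v₄) (w34 : v₃ ≠ v₄) (m₀ : v₀ ∈ e₀) (m₀' : v₁ ∈ e₀) (m₁ : v₁ ∈ e₁) (m₁' : v₂ ∈ e₁)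
    (m₂ : v₂ ∈ e₂) (m₂' : v₃ ∈ e₂) (m₃ : v₃ ∈ e₃) (m₃' : v₄ ∈ e₃) (m₄ : v₄ ∈ e₄) (m₄' : v₀ ∈ e₄) :
    H.HasBergeCycle 5 := by
  refine ⟨by norm_num, ![v₀, v₁, v₂, v₃, v₄], ![e₀, e₁, e₂, e₃, e₄], ?_, ?_, ?_⟩
  · intro i j h; fin_cases i <;> fin_cases j <;> simp_all
  · intro i j h; fin_cases i <;> fin_cases j <;> simp_all
  · intro i
    rw [finRotate_apply]
    fin_cases i <;> simp_all

/-- The shadow graph: two vertices are adjacent if some edge contains both. -/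
def shadow (H : Hypergraph α) : SimpleGraph α where
  Adj x y := x ≠ y ∧ ∃ e ∈ H.edgeSet, x ∈ e ∧ y ∈ e
  symm := ⟨fun _ _ ⟨h, e, he, hx, hy⟩ => ⟨h.symm, e, he, hy, hx⟩⟩
  loopless := ⟨fun _ h => h.1 rfl⟩

lemma not_four_mem_of_encard_eq_three {e : Set α} (he : e.encard = 3) {a b c d : α} (ha : a ∈ e)
    (hb : b ∈ e) (hc : c ∈ e) (hd : d ∈ e) (hab : a ≠ b) (hac : a ≠ c) (had : a ≠ d) (hbc : b ≠ c)
    (hbd : b ≠ d) (hcd : c ≠ d) : False := by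
  obtain ⟨x, y, z, -, -, -, rfl⟩ := Set.encard_eq_three.1 he
  simp only [Set.mem_insert_iff, Set.mem_singleton_iff] at ha hb hc hd
  grind

/-- One edge `e` covers two consecutive sides. It misses `v`, so the edges through `v` close a Berge
cycle of length two or three with `e`. -/
lemma shadow_four_cycle_chord (h3 : ∀ e ∈ H.edgeSet, e.encard = 3)
    (hc : ∀ k ≤ 5, ¬ H.HasBergeCycle k) {x u y v : α} {e f g : Set α} (he : e ∈ H.edgeSet)
    (hf : f ∈ H.edgeSet) (hg : g ∈ H.edgeSet) (hxu : x ≠ u) (hxy : x ≠ y) (hxv : x ≠ v)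
    (huy : u ≠ y) (huv : u ≠ v) (hyv : y ≠ v) (hxe : x ∈ e) (hue : u ∈ e) (hye : y ∈ e)
    (hyf : y ∈ f) (hvf : v ∈ f) (hvg : v ∈ g) (hxg : x ∈ g) : False := by
  have hve : v ∉ e := fun hve =>
    not_four_mem_of_encard_eq_three (h3 e he) hxe hue hye hve hxu hxy hxv huy huv hyv
  have hef : e ≠ f := fun h => hve (h ▸ hvf)
  have heg : e ≠ g := fun h => hve (h ▸ hvg)
  by_cases hfg : f = g
  · subst hfg
    exact hc 2 (by norm_num) (hasBergeCycle_two he hf hef hxy hxe hye hxg hyf)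
  · exact hc 3 (by norm_num) (hasBergeCycle_three he hf hg hef heg hfg hxy hxv hyv hxe hye hyf hvf
      hvg hxg)

/-- If the four covering edges are distinct they form a Berge cycle. Equal neighbouring ones are
excluded by the chord lemma, equal opposite ones by having only three vertices. -/
lemma fourCycleFree_shadow (h3 : ∀ e ∈ H.edgeSet, e.encard = 3)
    (hc : ∀ k ≤ 5, ¬ H.HasBergeCycle k) : FourCycleFree (shadow H) := by
  rintro x y u v hxy ⟨hxu, e₀, he₀, hx₀, hu₀⟩ ⟨huy, e₁, he₁, hu₁, hy₁⟩ ⟨hxv, e₃, he₃, hx₃, hv₃⟩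
    ⟨hvy, e₂, he₂, hv₂, hy₂⟩
  by_contra huv
  have chord := @shadow_four_cycle_chord _ _ h3 hc
  have h01 : e₀ ≠ e₁ := by
    rintro rfl
    exact chord he₀ he₂ he₃ hxu hxy hxv huy huv hvy.symm hx₀ hu₀ hy₁ hy₂ hv₂ hv₃ hx₃
  have h02 : e₀ ≠ e₂ := by
    rintro rfl
    exact not_four_mem_of_encard_eq_three (h3 _ he₀) hx₀ hu₀ hy₂ hv₂ hxu hxy hxv huy huv hvy.symm
  have h03 : e₀ ≠ e₃ := by
    rintro rfl
    exact chord he₀ he₁ he₂ hxv.symm (Ne.symm huv) hvy hxu hxy huy hv₃ hx₀ hu₀ hu₁ hy₁ hy₂ hv₂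
  have h12 : e₁ ≠ e₂ := by
    rintro rfl
    exact chord he₁ he₃ he₀ huy huv hxu.symm hvy.symm hxy.symm hxv.symm hu₁ hy₁ hv₂ hv₃ hx₃ hx₀ hu₀
  have h13 : e₁ ≠ e₃ := by
    rintro rfl
    exact not_four_mem_of_encard_eq_three (h3 _ he₁) hx₃ hu₁ hy₁ hv₃ hxu hxy hxv huy huv hvy.symm
  have h23 : e₂ ≠ e₃ := by
    rintro rfl
    exact chord he₂ he₀ he₁ hvy.symm hxy.symm huy.symm hxv.symm (Ne.symm huv) hxu hy₂ hv₂ hx₃ hx₀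
      hu₀ hu₁ hy₁
  exact hc 4 (by norm_num) (hasBergeCycle_four he₀ he₁ he₂ he₃ h01 h02 h03 h12 h13 h23 hxu hxy hxv
    huy huv hvy.symm hx₀ hu₀ hu₁ hy₁ hy₂ hv₂ hv₃ hx₃)

/-- A diagonal would create a four-cycle in the shadow. Two equal covering edges would contain a
diagonal, so all five are distinct. -/
lemma fiveCycleFree_shadow (h3 : ∀ e ∈ H.edgeSet, e.encard = 3)
    (hc : ∀ k ≤ 5, ¬ H.HasBergeCycle k) : FiveCycleFree (shadow H) := by
  intro v₀ v₁ v₂ v₃ v₄ a₀ a₁ a₂ a₃ a₄ h02 h03 h13 h14 h24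
  have h4 := fourCycleFree_shadow h3 hc
  have c02 : ¬ (shadow H).Adj v₀ v₂ := fun h => h24 (h4 v₀ v₃ v₂ v₄ h03 h a₂ a₄.symm a₃.symm)
  have c13 : ¬ (shadow H).Adj v₁ v₃ := fun h => h03 (h4 v₁ v₄ v₀ v₃ h14 a₀.symm a₄.symm h a₃)
  have c24 : ¬ (shadow H).Adj v₂ v₄ := fun h =>
    h14 (h4 v₂ v₀ v₁ v₄ h02.symm a₁.symm a₀.symm h a₄)
  have c30 : ¬ (shadow H).Adj v₃ v₀ := fun h =>
    h02.symm (h4 v₃ v₁ v₂ v₀ h13.symm a₂.symm a₁.symm h a₀)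
  have c41 : ¬ (shadow H).Adj v₄ v₁ := fun h =>
    h13.symm (h4 v₄ v₂ v₃ v₁ h24.symm a₃.symm a₂.symm h a₁)
  obtain ⟨w01, e₀, he₀, m₀, m₀'⟩ := a₀
  obtain ⟨w12, e₁, he₁, m₁, m₁'⟩ := a₁
  obtain ⟨w23, e₂, he₂, m₂, m₂'⟩ := a₂
  obtain ⟨w34, e₃, he₃, m₃, m₃'⟩ := a₃
  obtain ⟨w40, e₄, he₄, m₄, m₄'⟩ := a₄
  refine hc 5 le_rfl (hasBergeCycle_five he₀ he₁ he₂ he₃ he₄ ?_ ?_ ?_ ?_ ?_ ?_ ?_ ?_ ?_ ?_ w01 h02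
    h03 w40.symm w12 h13 h14 w23 h24 w34 m₀ m₀' m₁ m₁' m₂ m₂' m₃ m₃' m₄ m₄') <;> rintro rfl
  · exact c02 ⟨h02, _, he₀, m₀, m₁'⟩
  · exact c02 ⟨h02, _, he₀, m₀, m₂⟩
  · exact c30 ⟨h03.symm, _, he₀, m₃, m₀⟩
  · exact c41 ⟨h14.symm, _, he₀, m₄, m₀'⟩
  · exact c13 ⟨h13, _, he₁, m₁, m₂'⟩
  · exact c13 ⟨h13, _, he₁, m₁, m₃⟩
  · exact c41 ⟨h14.symm, _, he₁, m₄, m₁⟩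
  · exact c24 ⟨h24, _, he₂, m₂, m₃'⟩
  · exact c24 ⟨h24, _, he₂, m₂, m₄⟩
  · exact c30 ⟨h03.symm, _, he₃, m₃, m₄'⟩

/-- Every edge of a `3`-graph spans a triangle of its shadow. -/
lemma ncard_edgeSet_le_sum_triangleKernel [Fintype α] (h3 : ∀ e ∈ H.edgeSet, e.encard = 3) :
    (H.edgeSet.ncard : ℝ) ≤ ∑ x, ∑ y, ∑ z, triangleKernel (shadow H) x y z := by
  classical
  set S : Finset (α × α × α) := Finset.univ.filter fun p =>
    (shadow H).Adj p.1 p.2.1 ∧ (shadow H).Adj p.2.1 p.2.2 ∧ (shadow H).Adj p.2.2 p.1 with hS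
  have hsum : ∑ x, ∑ y, ∑ z, triangleKernel (shadow H) x y z = (S.card : ℝ) := by
    rw [hS, Finset.card_filter]
    push_cast
    rw [Fintype.sum_prod_type]
    refine Finset.sum_congr rfl fun x _ => ?_
    rw [Fintype.sum_prod_type]
    refine Finset.sum_congr rfl fun y _ => Finset.sum_congr rfl fun z _ => ?_
    simp only [triangleKernel, adjKernel]
    by_cases h1 : (shadow H).Adj x y <;> by_cases h2 : (shadow H).Adj y z <;>
      by_cases h3 : (shadow H).Adj z x <;> simp [h1, h2, h3]
  rw [hsum]
  have hsub : H.edgeSet ⊆ ↑(S.image fun p => ({p.1, p.2.1, p.2.2} : Set α)) := by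
    intro e he
    obtain ⟨x, y, z, hxy, hxz, hyz, rfl⟩ := Set.encard_eq_three.1 (h3 e he)
    refine Finset.mem_coe.2 (Finset.mem_image.2 ⟨(x, y, z), ?_, rfl⟩)
    refine Finset.mem_filter.2 ⟨Finset.mem_univ _, ⟨hxy, _, he, ?_⟩, ⟨hyz, _, he, ?_⟩,
      ⟨hxz.symm, _, he, ?_⟩⟩ <;> simp
  refine Nat.cast_le.2 ((Set.ncard_le_ncard hsub (Finset.finite_toSet _)).trans ?_)
  rw [Set.ncard_coe_finset]
  exact Finset.card_image_le

end Cycles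

end BergeGirth

/-! ### Reduction of both statements to 3-graphs without short cycles. -/

namespace BergeGirth

open Hypergraph

/-- A `3`-graph on `n` vertices without short Berge cycles has `o(n ^ (3 / 2))` edges. -/
theorem eventually_ncard_edgeSet_le {ε : ℝ} (hε : 0 < ε) :
    ∀ᶠ n : ℕ in atTop, ∀ H : Hypergraph (Fin n), (∀ e ∈ H.edgeSet, e.encard = 3) →
      (∀ k ≤ 5, ¬ H.HasBergeCycle k) → (H.edgeSet.ncard : ℝ) ≤ ε * (n : ℝ) ^ (3 / 2 : ℝ) := by
  obtain ⟨R, hR⟩ := sum_triangleKernel_lt hε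
  have htend : Tendsto (fun n : ℕ => √(n : ℝ)) atTop atTop :=
    Real.tendsto_sqrt_atTop.comp tendsto_natCast_atTop_atTop
  filter_upwards [htend.eventually_ge_atTop R] with n hn H h3 hc
  refine (ncard_edgeSet_le_sum_triangleKernel h3).trans ?_
  refine (hR _ (shadow H) (fourCycleFree_shadow h3 hc) (fiveCycleFree_shadow h3 hc) _ hn
    (by simp)).le.trans (le_of_eq ?_)
  rw [Real.sqrt_eq_rpow, ← Real.rpow_natCast, ← Real.rpow_mul (Nat.cast_nonneg n)]
  norm_num

lemma hasBergeCycle_of_image {α : Type*} {H H' : Hypergraph α} (t : Set α → Set α)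
    (ht : ∀ e ∈ H.edgeSet, t e ⊆ e) (hH' : H'.edgeSet = t '' H.edgeSet) {k : ℕ}
    (h : H'.HasBergeCycle k) : H.HasBergeCycle k := by
  obtain ⟨hk, v, e, hv, he, hi⟩ := h
  have hex : ∀ i, ∃ f ∈ H.edgeSet, t f = e i := fun i => by
    have := (hi i).1
    rwa [hH'] at this
  choose f hf hfe using hex
  refine ⟨hk, v, f, hv, fun i j hij => he (by rw [← hfe, ← hfe, hij]), fun i => ⟨hf i, ?_, ?_⟩⟩
  · exact ht _ (hf i) (by rw [hfe]; exact (hi i).2.1)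
  · exact ht _ (hf i) (by rw [hfe]; exact (hi i).2.2)

/-- Shrinking the edges of an `r`-graph of girth greater than five to triples. -/
lemma exists_three_graph {α : Type*} {H : Hypergraph α} {r : ℕ} (hr : 3 ≤ r)
    (hu : ∀ e ∈ H.edgeSet, e.encard = r) (hc : ∀ k ≤ 5, ¬ H.HasBergeCycle k) :
    ∃ H' : Hypergraph α, (∀ e ∈ H'.edgeSet, e.encard = 3) ∧ (∀ k ≤ 5, ¬ H'.HasBergeCycle k) ∧
      H'.edgeSet.ncard = H.edgeSet.ncard := by
  have hex : ∀ e : Set α, ∃ t, e ∈ H.edgeSet → t ⊆ e ∧ t.encard = 3 := by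
    intro e
    by_cases he : e ∈ H.edgeSet
    · obtain ⟨t, h1, h2⟩ := Set.exists_subset_encard_eq (s := e) (k := 3) (by
        rw [hu e he]; exact_mod_cast hr)
      exact ⟨t, fun _ => ⟨h1, h2⟩⟩
    · exact ⟨∅, fun h => (he h).elim⟩
  choose t ht using hex
  refine ⟨⟨Set.univ, t '' H.edgeSet, fun _ _ => Set.subset_univ _⟩, ?_, fun k hk h =>
    hc k hk (hasBergeCycle_of_image t (fun e he => (ht e he).1) rfl h), ?_⟩
  · rintro _ ⟨e, he, rfl⟩
    exact (ht e he).2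
  -- Two edges with the same triple would share two vertices, a Berge cycle of length two.
  · refine Set.InjOn.ncard_image (f := t) fun e he f hf hef => ?_
    by_contra hne
    obtain ⟨x, y, z, hxy, -, -, hxyz⟩ := Set.encard_eq_three.1 (ht e he).2
    have hx : x ∈ t e := by rw [hxyz]; simp
    have hy : y ∈ t e := by rw [hxyz]; simp
    exact hc 2 (by norm_num) (hasBergeCycle_two he hf hne hxy ((ht e he).1 hx) ((ht e he).1 hy)
      ((ht f hf).1 (hef ▸ hx)) ((ht f hf).1 (hef ▸ hy)))

lemma not_hasBergeCycle_of_lt_bergeGirth {α : Type*} {H : Hypergraph α} {g k : ℕ}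
    (hg : (g : ℕ∞) < H.bergeGirth) (hk : k ≤ g) : ¬ H.HasBergeCycle k := by
  intro h
  have h1 : H.bergeGirth ≤ (k : ℕ∞) := iInf₂_le k h
  have h2 : (k : ℕ∞) ≤ g := by exact_mod_cast hk
  exact absurd (hg.trans_le (h1.trans h2)) (lt_irrefl _)

section Configurations

variable {α : Type*} {H : Hypergraph α}

/-- The edges of a Berge cycle of length `k` in a `3`-graph span at most `2 * k` vertices. -/
lemma exists_finset_of_hasBergeCycle [Finite α] (h3 : ∀ e ∈ H.edgeSet, e.encard = 3) {k : ℕ}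
    (h : H.HasBergeCycle k) : ∃ S : Finset (Set α), ↑S ⊆ H.edgeSet ∧ S.card = k ∧ S.Nonempty ∧
      (⋃ e ∈ S, e).ncard ≤ 2 * k := by
  classical
  obtain ⟨hk, v, e, hv, he, hi⟩ := h
  refine ⟨Finset.univ.image e, ?_, ?_, ?_, ?_⟩
  · intro f hf
    simp only [Finset.coe_image, Finset.coe_univ, Set.image_univ, Set.mem_range] at hf
    obtain ⟨i, rfl⟩ := hf
    exact (hi i).1
  · rw [Finset.card_image_of_injective _ he, Finset.card_univ, Fintype.card_fin]
  · exact ⟨e ⟨0, by omega⟩, Finset.mem_image_of_mem _ (Finset.mem_univ _)⟩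
  -- Each `v i` also lies in the preceding edge, where it is not the removed vertex because `k ≥ 2`.
  -- So every edge contributes only two vertices.
  · have hsub : (⋃ f ∈ Finset.univ.image e, f) ⊆ ⋃ i, e i \ {v i} := by
      intro x hx
      simp only [Finset.mem_image, Finset.mem_univ, true_and, Set.iUnion_exists,
        Set.iUnion_iUnion_eq', Set.mem_iUnion] at hx
      obtain ⟨i, hxi⟩ := hx
      by_cases hxv : x = v i
      · obtain ⟨j, rfl⟩ := (finRotate k).surjective i
        refine Set.mem_iUnion.2 ⟨j, ?_, ?_⟩
        · rw [hxv]; exact (hi j).2.2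
        · rw [hxv, Set.mem_singleton_iff]
          intro hj
          have := hv hj
          obtain ⟨m, rfl⟩ : ∃ m, k = m + 2 := ⟨k - 2, by omega⟩
          rw [finRotate_apply] at this
          simp at this
      · exact Set.mem_iUnion.2 ⟨i, hxi, hxv⟩
    refine (Set.ncard_le_ncard hsub (Set.toFinite _)).trans
      ((Set.ncard_iUnion_le_of_fintype _).trans ?_)
    have h2 : ∀ i, (e i \ {v i}).ncard = 2 := fun i => by
      rw [Set.ncard_sdiff_singleton_of_mem (hi i).2.1, Set.ncard, h3 _ (hi i).1]
      rfl
    simp [h2, mul_comm]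

/-- A set of at most five edges spanning few vertices, with an edge all of whose vertices have
degree at least five, extends to a `(10, 5)`-configuration. -/
lemma hasConfiguration_of_finset [Finite α] (h3 : ∀ e ∈ H.edgeSet, e.encard = 3) {e₀ : Set α}
    (he₀ : ∀ u ∈ e₀, 5 ≤ {e ∈ H.edgeSet | u ∈ e}.ncard) (j : ℕ) :
    ∀ S : Finset (Set α), ↑S ⊆ H.edgeSet → S.card + j = 5 → e₀ ∈ S →
      (⋃ e ∈ S, e).ncard ≤ 2 * S.card → H.HasConfiguration 10 5 := by
  classical
  induction j with
  | zero =>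
    intro S hS hcard _ hU
    rw [add_zero] at hcard
    refine ⟨⟨⋃ e ∈ S, e, ↑S, fun e he x hx => Set.mem_biUnion (Finset.mem_coe.1 he) hx⟩, ⟨?_, hS⟩, ?_, ?_⟩
    · exact Set.iUnion₂_subset fun e he => H.subset_vertexSet_of_mem_edgeSet' (hS he)
    · change (↑S : Set (Set α)).encard = _
      rw [Set.encard_coe_eq_coe_finsetCard, hcard]
    · change (⋃ e ∈ S, e).encard ≤ _
      rw [← (Set.toFinite _).cast_ncard_eq]
      rw [hcard] at hU
      exact_mod_cast hU
  | succ j ih =>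
    intro S hS hcard hmem hU
    have hne : e₀.Nonempty := by
      rw [← Set.encard_ne_zero, h3 e₀ (hS hmem)]
      norm_num
    obtain ⟨u, hu⟩ := hne
    -- Fewer than five edges are used so far, so some new edge passes through `u`; it adds at most
    -- two vertices.
    obtain ⟨f, ⟨hfE, huf⟩, hfS⟩ := Set.exists_mem_notMem_of_ncard_lt_ncard
      (s := (↑S : Set (Set α))) (t := {e ∈ H.edgeSet | u ∈ e})
      (by rw [Set.ncard_coe_finset]; have := he₀ u hu; omega)
    have hfS' : f ∉ S := hfS
    refine ih (insert f S) ?_ ?_ (Finset.mem_insert_of_mem hmem) ?_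
    · rw [Finset.coe_insert]
      exact Set.insert_subset hfE hS
    · rw [Finset.card_insert_of_notMem hfS']
      omega
    · rw [Finset.card_insert_of_notMem hfS']
      have hsub : (⋃ e ∈ insert f S, e) ⊆ (⋃ e ∈ S, e) ∪ (f \ {u}) := by
        intro x hx
        simp only [Finset.mem_insert, Set.iUnion_iUnion_eq_or_left, Set.mem_union,
          Set.mem_iUnion, exists_prop] at hx
        rcases hx with hx | ⟨e, he, hx⟩
        · by_cases hxu : x = u
          · exact Or.inl (Set.mem_biUnion hmem (hxu ▸ hu))
          · exact Or.inr ⟨hx, hxu⟩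
        · exact Or.inl (Set.mem_biUnion he hx)
      have h2 : (f \ {u}).ncard = 2 := by
        rw [Set.ncard_sdiff_singleton_of_mem huf, Set.ncard, h3 _ hfE]
        rfl
      have := (Set.ncard_le_ncard hsub (Set.toFinite _)).trans (Set.ncard_union_le _ _)
      omega

/-- Removing the edges with a vertex of degree at most four from a `3`-graph without
`(10, 5)`-configurations destroys all short cycles and costs a linear number of edges. -/
lemma exists_large_girth_subgraph [Fintype α] (h3 : ∀ e ∈ H.edgeSet, e.encard = 3)
    (hc : ¬ H.HasConfiguration 10 5) :
    ∃ H' : Hypergraph α, (∀ e ∈ H'.edgeSet, e.encard = 3) ∧ (∀ k ≤ 5, ¬ H'.HasBergeCycle k) ∧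
      H.edgeSet.ncard ≤ H'.edgeSet.ncard + 4 * Fintype.card α := by
  classical
  -- Degrees are taken in `H`, not in `E'`: the extending edges may be deleted ones, so one round of
  -- deletion suffices.
  set E' : Set (Set α) := {e ∈ H.edgeSet | ∀ u ∈ e, 5 ≤ {f ∈ H.edgeSet | u ∈ f}.ncard} with hE'
  have hE'3 : ∀ e ∈ E', e.encard = 3 := fun e he => h3 e he.1
  refine ⟨⟨Set.univ, E', fun _ _ => Set.subset_univ _⟩, hE'3, fun k hk hcyc => ?_, ?_⟩
  · obtain ⟨S, hS, hcard, ⟨e₀, he₀⟩, hU⟩ := exists_finset_of_hasBergeCycle hE'3 hcyc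
    exact hc (hasConfiguration_of_finset h3 (hS he₀).2 (5 - k) S (fun e he => (hS he).1)
      (by omega) he₀ (by rw [hcard]; exact hU))
  · set B : α → Set (Set α) := fun u =>
      if {f ∈ H.edgeSet | u ∈ f}.ncard ≤ 4 then {f ∈ H.edgeSet | u ∈ f} else ∅ with hB
    have hsub : H.edgeSet ⊆ E' ∪ ⋃ u, B u := by
      intro e he
      by_cases h : e ∈ E'
      · exact Or.inl h
      · right
        simp only [hE', Set.mem_sep_iff, he, true_and, not_forall] at h
        obtain ⟨u, hu, hlt⟩ := h
        refine Set.mem_iUnion.2 ⟨u, ?_⟩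
        simp only [hB]
        rw [if_pos (by omega)]
        exact ⟨he, hu⟩
    have hBu : ∀ u, (B u).ncard ≤ 4 := fun u => by
      simp only [hB]
      split_ifs with h
      · exact h
      · simp
    have h1 := (Set.ncard_le_ncard hsub (Set.toFinite _)).trans (Set.ncard_union_le _ _)
    have h2 : (⋃ u, B u).ncard ≤ 4 * Fintype.card α := by
      refine (Set.ncard_iUnion_le_of_fintype _).trans ((Finset.sum_le_sum fun u _ => hBu u).trans ?_)
      simp [mul_comm]
    change H.edgeSet.ncard ≤ E'.ncard + _
    omega

end Configurations

end BergeGirth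

theorem mainTheorem5 :
    (∀ r : ℕ, 3 ≤ r →
      (fun n : ℕ => (Hypergraph.maxEdgesGirth r n 5 : ℝ))
        =o[atTop] (fun n : ℕ => (n : ℝ) ^ (3 / 2 : ℝ))) ∧
    (fun n : ℕ => (Hypergraph.maxEdgesConfigurationFree 3 n 10 5 : ℝ))
      =o[atTop] (fun n : ℕ => (n : ℝ) ^ (3 / 2 : ℝ)) := by
  have hnorm : ∀ n : ℕ, ‖(n : ℝ) ^ (3 / 2 : ℝ)‖ = (n : ℝ) ^ (3 / 2 : ℝ) := fun n =>
    Real.norm_of_nonneg (Real.rpow_nonneg (Nat.cast_nonneg n) _)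
  refine ⟨fun r hr => isLittleO_iff.2 fun ε hε => ?_, isLittleO_iff.2 fun ε hε => ?_⟩
  · filter_upwards [BergeGirth.eventually_ncard_edgeSet_le hε] with n hn
    obtain ⟨H, hu, hg, hm⟩ := (Hypergraph.isGreatest_maxEdgesGirth r n 5).1
    obtain ⟨H', h3, hc, hcard⟩ := BergeGirth.exists_three_graph hr hu.edge_encard fun k hk =>
      BergeGirth.not_hasBergeCycle_of_lt_bergeGirth hg hk
    rw [hnorm, Real.norm_natCast, ← hm, ← hcard]
    exact hn H' h3 hc
  -- Half of `ε` pays for the deleted edges, the other half for the 3-graph that remains.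
  · have hlin : ∀ᶠ n : ℕ in atTop, 4 * (n : ℝ) ≤ ε / 2 * (n : ℝ) ^ (3 / 2 : ℝ) := by
      have htend : Tendsto (fun n : ℕ => (n : ℝ) ^ (1 / 2 : ℝ)) atTop atTop :=
        (tendsto_rpow_atTop (by norm_num)).comp tendsto_natCast_atTop_atTop
      filter_upwards [htend.eventually_ge_atTop (8 / ε), eventually_gt_atTop 0] with n hn h0
      have h0' : (0 : ℝ) < n := by exact_mod_cast h0
      rw [div_le_iff₀ hε] at hn
      rw [show (3 / 2 : ℝ) = 1 + 1 / 2 by norm_num, Real.rpow_add h0', Real.rpow_one]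
      nlinarith
    filter_upwards [BergeGirth.eventually_ncard_edgeSet_le (half_pos hε), hlin] with n hn hn'
    obtain ⟨H, hu, hg, hm⟩ :=
      (Hypergraph.isGreatest_maxEdgesConfigurationFree 3 n 10 5 (by norm_num)).1
    obtain ⟨H', h3, hc, hcard⟩ := BergeGirth.exists_large_girth_subgraph hu.edge_encard hg
    rw [hnorm, Real.norm_natCast, ← hm]
    have h1 := hn H' h3 hc
    have h2 : (H.edgeSet.ncard : ℝ) ≤ H'.edgeSet.ncard + 4 * (n : ℝ) := by
      rw [Fintype.card_fin] at hcard
      exact_mod_cast hcard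
    linarith
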